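/- Let $G$ be a finite-dimensional real Lie group, let $k=\mathbb R$ or $\mathbb C$, and let $\mathfrak g$ be its Lie algebra with scalars extended to $k$. For $v\in\mathfrak g$, $g\in G$ and a $k$-valued smooth function $a$, write $a'(g;gv)$ and $a'(g;vg)$ for the derivatives of $a$ at $g$ along the left- and right-invariant vector fields given by $v$ (extended $k$-linearly in $v$), and put $\hat L_a(g)(v)=a'(g;gv)$. For a $k$-valued 1-form $\tau$ put $\tilde\tau(g)=L_g^*(\tau(g))\in\mathfrak g^*$, where $L_g$ is left translation by $g$. Tensors $t\in\mathfrak g\otimes\mathfrak g$ are written $t=t^{[1]}\otimes t^{[2]}$ (summation understood), and $t_{21}=t^{[2]}\otimes t^{[1]}$. Let $r\in\mathfrak g\otimes\mathfrak g$ make $G$ a quasitriangular Poisson–Lie group: $r$ satisfies the classical Yang–Baxter equation $[r_{12},r_{13}]+[r_{12},r_{23}]+[r_{13},r_{23}]=0$, and $\omega(g)=gr-rg$ is a Poisson (in particular skew) bivector, with bracket $$\{a,b\}(g)=a'(g;gr^{[1]})\,b'(g;gr^{[2]})-a'(g;r^{[1]}g)\,b'(g;r^{[2]}g).$$ Let $r_\pm=\tfrac12(r\pm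 r_{21})$. The canonical preconnection $\gamma_{\rm can}$ of $(G,r)$ is the left-invariant preconnection with $\hat\Xi=0$. That is, with $\mathrm{ad}^*_v\psi(w)=\psi([w,v])$ and $\Xi(\phi,\psi)=\hat\Xi(\phi,\psi)+\phi(r_-^{[1]})\,\mathrm{ad}^*_{r_-^{[2]}}\psi$, it is given in the left trivialisation by $$\widetilde{\gamma_{\rm can}(a,\tau)}(g)=\{a,\tilde\tau\}(g)+\Xi(\hat L_a(g),\tilde\tau(g)),\qquad \hat\Xi=0 .$$ Let $H$ be a Hopf algebra of smooth $k$-valued functions on $G$ (pointwise product, $\Delta a(x,y)=a(xy)$, $\epsilon(a)=a(e)$), and let $\Omega^1(H)$ be its classical bicovariant calculus: the span of the forms $a\,\mathrm db$, $a,b\in H$, with the coactions $(\Delta_L\tau)(x,g)=L_x^*(\tau(xg))$ and $(\Delta_R\tau)(g,x)=R_x^*(\tau(gx))$ of $H$. Write $(\mathrm{id}\otimes\Delta_R)\Delta_L\tau=\tau_{(1)}\otimes\tau_{(2)}\otimes\tau_{(3)}\in H\otimes\Omega^1(H)\otimes H$. Let $F:H\otimes H\to k[[\hbar]]$ be a 2-cochain,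 i.e. linear, convolution-invertible and with $F(1\otimes a)=\epsilon(a)$, and suppose $$F=1\otimes1+\hbar f+O(\hbar^2),$$ where $1\otimes 1$ stands for $\epsilon\otimes\epsilon$ and $f:H\otimes H\to k$. Suppose that the quasitriangular structure resulting from the twist is $r$, i.e. $$r=f_{21}-f+r_+$$ as functionals on $H\otimes H$, where $f_{21}(a\otimes b)=f(b\otimes a)$ and $v\in\mathfrak g$ acts on functions by differentiation at the identity. Consider the twisted products $$a\bullet b=F(a_{(1)}\otimes b_{(1)})\,a_{(2)}b_{(2)}\,F^{-1}(a_{(3)}\otimes b_{(3)}),$$ $$a\bullet\tau=F(a_{(1)}\otimes\tau_{(1)})\,a_{(2)}\tau_{(2)}\,F^{-1}(a_{(3)}\otimes\tau_{(3)}),\qquad \tau\bullet a=F(\tau_{(1)}\otimes a_{(1)})\,\tau_{(2)}a_{(2)}\,F^{-1}(\tau_{(3)}\otimes a_{(3)})$$ for $a,b\in H$ and $\tau\in\Omega^1(H)$. Then the twisted calculus semiclassicalises to the canonical preconnection: $a\bullet b=ab+O(\hbar)$, $a\bullet b-b\bullet a=\hbar\{a,b\}+O(\hbar^2)$, $a\bullet\tau=a\tau+O(\hbar)$,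 $\tau\bullet a=a\tau+O(\hbar)$, and $$a\bullet\tau-\tau\bullet a=\hbar\,\gamma_{\rm can}(a,\tau)+O(\hbar^2).$$ Explicitly, the coefficient of $\hbar$ in $a\bullet\tau-\tau\bullet a$ is also given by $$(a\triangleleft r_-^{[1]})(\tau\triangleleft r_-^{[2]})-(r_-^{[1]}\triangleright a)(r_-^{[2]}\triangleright\tau),$$ where $\triangleright,\triangleleft$ are the infinitesimal forms of the actions $(h\triangleright a)(g)=a(h^{-1}g)$, $(a\triangleleft h)(g)=a(gh^{-1})$ of $G$ on functions and $(h\triangleright\tau)(g)=L_{h^{-1}}^*(\tau(h^{-1}g))$, $(\tau\triangleleft h)(g)=R_{h^{-1}}^*(\tau(gh^{-1}))$ on 1-forms. -/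

import Mathlib

open scoped Manifold ContDiff TensorProduct

noncomputable section

namespace CochainTwist

/-! ### Classical Yang-Baxter equation and (anti)symmetric parts -/

section LieAlgebra

variable {R L : Type*} [CommRing R] [LieRing L] [LieAlgebra R L]

/-- The Lie bracket as a bilinear map. -/
def bracketBilin (R L : Type*) [CommRing R] [LieRing L] [LieAlgebra R L] : L →ₗ[R] L →ₗ[R] L :=
  (LieAlgebra.ad R L : L →ₗ[R] Module.End R L)

/-- `[s₁₂, t₁₃]`, i.e. `(a ⊗ b, c ⊗ d) ↦ [a, c] ⊗ b ⊗ d`. -/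
def bracket12_13 (s t : L ⊗[R] L) : L ⊗[R] (L ⊗[R] L) :=
  TensorProduct.map₂ (bracketBilin R L) (TensorProduct.mk R L L) s t

/-- `[s₁₂, t₂₃]`, i.e. `(a ⊗ b, c ⊗ d) ↦ a ⊗ [b, c] ⊗ d`. -/
def bracket12_23 (s t : L ⊗[R] L) : L ⊗[R] (L ⊗[R] L) :=
  LinearMap.lTensor L
    (LinearMap.rTensor L (TensorProduct.lift (bracketBilin R L)) ∘ₗ
      (TensorProduct.assoc R L L L).symm.toLinearMap)
    (TensorProduct.assoc R L L (L ⊗[R] L) (s ⊗ₜ[R] t))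

/-- `[s₁₃, t₂₃]`, i.e. `(a ⊗ b, c ⊗ d) ↦ a ⊗ c ⊗ [b, d]`. -/
def bracket13_23 (s t : L ⊗[R] L) : L ⊗[R] (L ⊗[R] L) :=
  TensorProduct.assoc R L L L
    (TensorProduct.map₂ (TensorProduct.mk R L L) (bracketBilin R L) s t)

/-- The Schouten bracket `[[r, r]] = [r₁₂, r₁₃] + [r₁₂, r₂₃] + [r₁₃, r₂₃]`. -/
def schouten (r : L ⊗[R] L) : L ⊗[R] (L ⊗[R] L) :=
  bracket12_13 r r + bracket12_23 r r + bracket13_23 r r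

end LieAlgebra

section Parts

variable {K V : Type*} [Field K] [AddCommGroup V] [Module K V]

/-- `r₊ = (r + r₂₁) / 2`. -/
def symmPart (r : V ⊗[K] V) : V ⊗[K] V := (2⁻¹ : K) • (r + TensorProduct.comm K V V r)

/-- `r₋ = (r - r₂₁) / 2`. -/
def skewPart (r : V ⊗[K] V) : V ⊗[K] V := (2⁻¹ : K) • (r - TensorProduct.comm K V V r)

/-- `(φ ⊗ ψ)(t)` for two linear forms and a 2-tensor `t`. -/
def pair (φ ψ : Module.Dual K V) (t : V ⊗[K] V) : K :=
  LinearMap.mul' K K (TensorProduct.map φ ψ t)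

end Parts

/-! ### Invariant calculus on a Lie group

`G` is a real Lie group; functions and forms take values in `K = ℝ` or `K = ℂ`, and
`g_K = K ⊗ Lie G` is the correspondingly extended Lie algebra. -/

section LieGroup

variable {E : Type*} [NormedAddCommGroup E] [NormedSpace ℝ E]
  (K : Type*) [RCLike K]
  (G : Type*) [TopologicalSpace G] [ChartedSpace E G] [Group G]

/-- The Lie algebra of `G`, with scalars extended to `K`. -/
abbrev LieAlg : Type _ := K ⊗[ℝ] GroupLieAlgebra 𝓘(ℝ, E) G

/-- `K`-valued (a priori not necessarily smooth) 1-forms on `G`. -/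
abbrev Form : Type _ := (g : G) → (TangentSpace 𝓘(ℝ, E) g →L[ℝ] K)

variable {K G}

/-- The `K`-linear extension to `g_K` of the differential of `b` at the identity. -/
def diffOne (b : G → K) : Module.Dual K (LieAlg (E := E) K G) :=
  LinearMap.liftBaseChange K
    (show GroupLieAlgebra 𝓘(ℝ, E) G →L[ℝ] K from
      mfderiv 𝓘(ℝ, E) 𝓘(ℝ, K) b (1 : G)).toLinearMap

/-- `v ↦ a'(g; g v)`, the derivative along left invariant vector fields; this is `L̂_a(g)`. -/
def derivL (a : G → K) (g : G) : Module.Dual K (LieAlg (E := E) K G) :=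
  diffOne fun x => a (g * x)

/-- `v ↦ a'(g; v g)`, the derivative along right invariant vector fields. -/
def derivR (a : G → K) (g : G) : Module.Dual K (LieAlg (E := E) K G) :=
  diffOne fun x => a (x * g)

/-- The translate `x w ∈ T_{xg} G` of `w ∈ T_g G`. -/
def transL (x g : G) (w : TangentSpace 𝓘(ℝ, E) g) : TangentSpace 𝓘(ℝ, E) (x * g) :=
  mfderiv 𝓘(ℝ, E) 𝓘(ℝ, E) (fun y : G => x * y) g w

/-- The translate `w x ∈ T_{gx} G` of `w ∈ T_g G`. -/
def transR (x g : G) (w : TangentSpace 𝓘(ℝ, E) g) : TangentSpace 𝓘(ℝ, E) (g * x) :=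
  mfderiv 𝓘(ℝ, E) 𝓘(ℝ, E) (fun y : G => y * x) g w

/-- The bracket `{a, b}` given by the bivector `ω(g) = g r - r g`. -/
def poisson (r : LieAlg (E := E) K G ⊗[K] LieAlg (E := E) K G) (a b : G → K) (g : G) : K :=
  pair (derivL a g) (derivL b g) r - pair (derivR a g) (derivR b g) r

/-- The function `τ̃(g) = L_g^* (τ(g))` with values in the dual of `g_K`,
i.e. the `K`-linear extension of `v ↦ τ(g)(g v)`. -/
def tilde (τ : Form (E := E) K G) (g : G) : Module.Dual K (LieAlg (E := E) K G) :=
  LinearMap.liftBaseChange K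
    ((τ g).comp (show GroupLieAlgebra 𝓘(ℝ, E) G →L[ℝ] TangentSpace 𝓘(ℝ, E) g from
      mfderiv 𝓘(ℝ, E) 𝓘(ℝ, E) (fun y : G => g * y) (1 : G))).toLinearMap

/-- `v ↦ (v ▷ a)(g)`, the infinitesimal left action on functions, from `(h ▷ a)(g) = a(h⁻¹ g)`. -/
def funLeftAct (a : G → K) (g : G) : Module.Dual K (LieAlg (E := E) K G) := -derivR a g

/-- `v ↦ (a ◁ v)(g)`, the infinitesimal right action on functions,
from `(a ◁ h)(g) = a(g h⁻¹)`. -/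
def funRightAct (a : G → K) (g : G) : Module.Dual K (LieAlg (E := E) K G) := -derivL a g

/-- `v ↦ (v ▷ τ)(g)(w)`, the infinitesimal left action on 1-forms,
from `(h ▷ τ)(g) = L_{h⁻¹}^* (τ(h⁻¹ g))`. -/
def formLeftAct (τ : Form (E := E) K G) (g : G) (w : TangentSpace 𝓘(ℝ, E) g) :
    Module.Dual K (LieAlg (E := E) K G) :=
  -diffOne fun x => τ (x * g) (transL x g w)

/-- `v ↦ (τ ◁ v)(g)(w)`, the infinitesimal right action on 1-forms,
from `(τ ◁ h)(g) = R_{h⁻¹}^* (τ(g h⁻¹))`. -/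
def formRightAct (τ : Form (E := E) K G) (g : G) (w : TangentSpace 𝓘(ℝ, E) g) :
    Module.Dual K (LieAlg (E := E) K G) :=
  -diffOne fun x => τ (g * x) (transR x g w)

variable [CompleteSpace E] [LieGroup 𝓘(ℝ, E) ∞ G]

instance lieGroupMinSmoothness : LieGroup 𝓘(ℝ, E) (minSmoothness ℝ 3) G :=
  LieGroup.of_le (n := ∞) (by
    rw [minSmoothness_of_isRCLikeNormedField]
    exact ENat.LEInfty.out)

/-- The coadjoint action `v ↦ ad^*_v ψ`, where `(ad^*_v ψ)(w) = ψ([w, v])`. -/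
def coad (ψ : Module.Dual K (LieAlg (E := E) K G)) :
    LieAlg (E := E) K G →ₗ[K] Module.Dual K (LieAlg (E := E) K G) :=
  (bracketBilin K (LieAlg (E := E) K G)).flip.compr₂ ψ

/-- `G` with the bivector `ω(g) = g r - r g` is a quasitriangular Poisson-Lie group: `r` solves the
classical Yang-Baxter equation and `ω` is skew, so that `{a, b} = ω(da, db)` is a Poisson bracket.
Skewness of `ω` amounts to `Ad`-invariance of `r₊`, and it makes
`δ v = ad_v(r)` a Lie cobracket. -/
structure IsQuasitriangular (r : LieAlg (E := E) K G ⊗[K] LieAlg (E := E) K G) : Prop where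
  cybe : schouten r = 0
  skew : ∀ a b : G → K, ContMDiff 𝓘(ℝ, E) 𝓘(ℝ, K) ∞ a → ContMDiff 𝓘(ℝ, E) 𝓘(ℝ, K) ∞ b →
    ∀ g, poisson r a b g = -poisson r b a g

/-- A bilinear map `g_K^* × g_K^* → g_K^*`. -/
abbrev DualBilin (E : Type*) [NormedAddCommGroup E] [NormedSpace ℝ E] (K : Type*) [RCLike K]
    (G : Type*) [TopologicalSpace G] [ChartedSpace E G] [Group G] : Type _ :=
  Module.Dual K (LieAlg (E := E) K G) →ₗ[K] Module.Dual K (LieAlg (E := E) K G) →ₗ[K]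
    Module.Dual K (LieAlg (E := E) K G)

/-- `(φ, ψ) ↦ φ(t¹) ad^*_{t²} ψ` for a 2-tensor `t = t¹ ⊗ t²`. -/
def coadTensor (t : LieAlg (E := E) K G ⊗[K] LieAlg (E := E) K G)
    (φ ψ : Module.Dual K (LieAlg (E := E) K G)) : Module.Dual K (LieAlg (E := E) K G) :=
  TensorProduct.lift (φ.smulRight (coad ψ)) t

/-- The map `Ξ` belonging to `Ξ̂`, namely `Ξ(φ, ψ) = Ξ̂(φ, ψ) + φ(r₋¹) ad^*_{r₋²} ψ`. -/
def xi (r : LieAlg (E := E) K G ⊗[K] LieAlg (E := E) K G) (xiHat : DualBilin E K G)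
    (φ ψ : Module.Dual K (LieAlg (E := E) K G)) : Module.Dual K (LieAlg (E := E) K G) :=
  xiHat φ ψ + coadTensor (skewPart r) φ ψ

/-- The left invariant preconnection with parameter `Ξ̂` in the left trivialisation,
`γ̃(a, s)(g) = {a, s}(g) + Ξ(L̂_a(g), s(g))`, evaluated on `v`. -/
def preconnTilde (r : LieAlg (E := E) K G ⊗[K] LieAlg (E := E) K G) (xiHat : DualBilin E K G)
    (a : G → K) (s : G → Module.Dual K (LieAlg (E := E) K G)) (g : G)
    (v : LieAlg (E := E) K G) : K :=
  poisson r a (fun x => s x v) g + xi r xiHat (derivL a g) (s g) v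

/-- The preconnection `γ` with parameter `Ξ̂`: `γ(a, τ)(g) = L_{g⁻¹}^* (γ̃(a, τ̃)(g))`, evaluated
on the tangent vector `w` at `g`. -/
def preconn (r : LieAlg (E := E) K G ⊗[K] LieAlg (E := E) K G) (xiHat : DualBilin E K G)
    (a : G → K) (τ : Form (E := E) K G) (g : G) (w : TangentSpace 𝓘(ℝ, E) g) : K :=
  preconnTilde r xiHat a (tilde τ) g
    (1 ⊗ₜ[ℝ] (show GroupLieAlgebra 𝓘(ℝ, E) G from
      mfderiv 𝓘(ℝ, E) 𝓘(ℝ, E) (fun y : G => g⁻¹ * y) g w))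

/-- The canonical preconnection, `Ξ̂ = 0`. -/
def canonicalPreconn (r : LieAlg (E := E) K G ⊗[K] LieAlg (E := E) K G)
    (a : G → K) (τ : Form (E := E) K G) (g : G) (w : TangentSpace 𝓘(ℝ, E) g) : K :=
  preconn r 0 a τ g w

end LieGroup

/-! ### Hopf algebras of functions and their classical calculus -/

section Functions

variable (E : Type*) [NormedAddCommGroup E] [NormedSpace ℝ E] (K : Type*) [RCLike K]
  (G : Type*) [TopologicalSpace G] [ChartedSpace E G] [Group G]
  (H : Type*) [CommRing H] [HopfAlgebra K H]
  (Γ : Type*) [AddCommGroup Γ] [Module K Γ] [Module H Γ] [IsScalarTower K H Γ]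

variable {E K G} in
/-- Evaluation of a form on the tangent vector `w` at `g`. -/
def evalForm (g : G) (w : TangentSpace 𝓘(ℝ, E) g) : Form (E := E) K G →ₗ[K] K where
  toFun τ := τ g w
  map_add' _ _ := rfl
  map_smul' _ _ := rfl

/-- `H` is a Hopf algebra of smooth functions on `G` and `Γ` its classical first order
bicovariant calculus, the span of the forms `a db` on `G`, with coactions given by translation:
`(Δ_L τ)(x, g) = L_x^* (τ(x g))` and `(Δ_R τ)(g, x) = R_x^* (τ(g x))`. -/
structure ClassicalCalculus where
  /-- elements of `H` as functions -/
  fn : H →ₐ[K] (G → K)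
  fn_injective : Function.Injective fn
  fn_smooth : ∀ a, ContMDiff 𝓘(ℝ, E) 𝓘(ℝ, K) ∞ (fn a)
  fn_comul : ∀ (a : H) (x y : G),
    LinearMap.mul' K K (TensorProduct.map (LinearMap.proj x ∘ₗ fn.toLinearMap)
      (LinearMap.proj y ∘ₗ fn.toLinearMap) (Coalgebra.comul (R := K) a)) = fn a (x * y)
  fn_counit : ∀ a : H, Coalgebra.counit (R := K) a = fn a 1
  /-- elements of `Γ` as 1-forms, evaluated on a tangent vector -/
  form : Γ →ₗ[K] Form (E := E) K G
  form_injective : Function.Injective form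
  form_smul : ∀ (a : H) (τ : Γ) (g : G), form (a • τ) g = fn a g • form τ g
  /-- the exterior derivative -/
  d : Derivation K H Γ
  form_d : ∀ (a : H) (g : G), form (d a) g = (show TangentSpace 𝓘(ℝ, E) g →L[ℝ] K from
    mfderiv 𝓘(ℝ, E) 𝓘(ℝ, K) (fn a) g)
  span_d : Submodule.span H (Set.range d) = ⊤
  /-- the left coaction -/
  coactL : Γ →ₗ[K] H ⊗[K] Γ
  /-- the right coaction -/
  coactR : Γ →ₗ[K] Γ ⊗[K] H
  coactL_apply : ∀ (τ : Γ) (x g : G) (w : TangentSpace 𝓘(ℝ, E) g),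
    LinearMap.mul' K K (TensorProduct.map (LinearMap.proj x ∘ₗ fn.toLinearMap)
      (evalForm g w ∘ₗ form) (coactL τ)) = form τ (x * g) (transL x g w)
  coactR_apply : ∀ (τ : Γ) (x g : G) (w : TangentSpace 𝓘(ℝ, E) g),
    LinearMap.mul' K K (TensorProduct.map (evalForm g w ∘ₗ form)
      (LinearMap.proj x ∘ₗ fn.toLinearMap) (coactR τ)) = form τ (g * x) (transR x g w)

end Functions

/-! ### Cochain twists

A series `∑ ħⁿ vₙ` in `V[[ħ]]` is written as its sequence of coefficients `ℕ → V`. -/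

section Twist

variable {K H : Type*} [Field K] [CommRing H] [HopfAlgebra K H]
  {M N P : Type*} [AddCommGroup M] [Module K M] [AddCommGroup N] [Module K N]
  [AddCommGroup P] [Module K P]

variable (K H) in
/-- Convolution invertible `K[[ħ]]`-valued functionals on `H ⊗ H`. -/
abbrev InvFunctional : Type _ := (WithConv (H ⊗[K] H →ₗ[K] PowerSeries K))ˣ

/-- The coefficient of `ħⁿ`. -/
def hbarCoeff (n : ℕ) (F : WithConv (H ⊗[K] H →ₗ[K] PowerSeries K)) : H ⊗[K] H →ₗ[K] K :=
  PowerSeries.coeff n ∘ₗ F.ofConv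

/-- `F = 1 ⊗ 1 + ħ f + O(ħ²)` is a 2-cochain: it is convolution invertible and
`F(1 ⊗ a) = ε(a)`. -/
structure IsCochain (F : InvFunctional K H) (f : H ⊗[K] H →ₗ[K] K) : Prop where
  unital : ∀ a : H, F.val.ofConv (1 ⊗ₜ[K] a) = PowerSeries.C (Coalgebra.counit (R := K) a)
  coeff_zero : hbarCoeff 0 F.val = Coalgebra.counit (R := K) (A := H ⊗[K] H)
  coeff_one : hbarCoeff 1 F.val = f

/-- `(h ⊗ m ⊗ h', k ⊗ n ⊗ k') ↦ Φ(h ⊗ k) μ(m, n) Ψ(h' ⊗ k')`. -/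
def twistTerm (Φ Ψ : H ⊗[K] H →ₗ[K] K) (μ : M →ₗ[K] N →ₗ[K] P) :
    H ⊗[K] (M ⊗[K] H) →ₗ[K] H ⊗[K] (N ⊗[K] H) →ₗ[K] P :=
  (TensorProduct.map₂ (TensorProduct.curry Φ)
    (TensorProduct.map₂ μ (TensorProduct.curry Ψ))).compr₂
    ((TensorProduct.rid K P).toLinearMap ∘ₗ (TensorProduct.lid K (P ⊗[K] K)).toLinearMap)

/-- The twisted product `F(m₁ ⊗ n₁) μ(m₂, n₂) F⁻¹(m₃ ⊗ n₃)` in `P[[ħ]]`, where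
`δM m = m₁ ⊗ m₂ ⊗ m₃` and `δN n = n₁ ⊗ n₂ ⊗ n₃`. -/
def twistedMul (F : InvFunctional K H) (δM : M →ₗ[K] H ⊗[K] (M ⊗[K] H))
    (δN : N →ₗ[K] H ⊗[K] (N ⊗[K] H)) (μ : M →ₗ[K] N →ₗ[K] P) (m : M) (n : N) : ℕ → P :=
  fun k => ∑ p ∈ Finset.HasAntidiagonal.antidiagonal k,
    twistTerm (hbarCoeff p.1 F.val) (hbarCoeff p.2 F⁻¹.val) μ (δM m) (δN n)

variable (K H) in
/-- `a ↦ a₁ ⊗ a₂ ⊗ a₃`. -/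
def comul₃ : H →ₗ[K] H ⊗[K] (H ⊗[K] H) :=
  LinearMap.lTensor H Coalgebra.comul ∘ₗ Coalgebra.comul

end Twist

section TwistedCalculus

variable {E : Type*} [NormedAddCommGroup E] [NormedSpace ℝ E] {K : Type*} [RCLike K]
  {G : Type*} [TopologicalSpace G] [ChartedSpace E G] [Group G]
  {H : Type*} [CommRing H] [HopfAlgebra K H]
  {Γ : Type*} [AddCommGroup Γ] [Module K Γ] [Module H Γ] [IsScalarTower K H Γ]

/-- `τ ↦ τ₁ ⊗ τ₂ ⊗ τ₃ ∈ H ⊗ Γ ⊗ H`, the two commuting coactions. -/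
def ClassicalCalculus.coact₃ (C : ClassicalCalculus E K G H Γ) : Γ →ₗ[K] H ⊗[K] (Γ ⊗[K] H) :=
  LinearMap.lTensor H C.coactR ∘ₗ C.coactL

/-- The product `a • b` of the twist `H_F`. -/
def bulletFun (F : InvFunctional K H) (a b : H) : ℕ → H :=
  twistedMul F (comul₃ K H) (comul₃ K H) (LinearMap.mul K H) a b

/-- The twisted left module structure `a • τ`. -/
def bulletLeft (C : ClassicalCalculus E K G H Γ) (F : InvFunctional K H) (a : H) (τ : Γ) : ℕ → Γ :=
  twistedMul F (comul₃ K H) C.coact₃ (Algebra.lsmul K K Γ).toLinearMap a τ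

/-- The twisted right module structure `τ • a`; classically `τ a = a τ`. -/
def bulletRight (C : ClassicalCalculus E K G H Γ) (F : InvFunctional K H) (τ : Γ) (a : H) : ℕ → Γ :=
  twistedMul F C.coact₃ (comul₃ K H) (Algebra.lsmul K K Γ).toLinearMap.flip τ a

/-- The functional `a ⊗ b ↦ ⟨t, a ⊗ b⟩` on `H ⊗ H` defined by a 2-tensor `t` on the Lie algebra,
which acts by differentiation at the identity. -/
def ClassicalCalculus.tensorPair (C : ClassicalCalculus E K G H Γ)
    (t : LieAlg (E := E) K G ⊗[K] LieAlg (E := E) K G) (a b : H) : K :=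
  pair (diffOne (C.fn a)) (diffOne (C.fn b)) t

/-- The quasitriangular structure obtained from a cochain with first order term `f` is `r`, i.e.
`r = f₂₁ - f + r₊` as functionals on `H ⊗ H`. -/
def ClassicalCalculus.Quantises (C : ClassicalCalculus E K G H Γ) (f : H ⊗[K] H →ₗ[K] K)
    (r : LieAlg (E := E) K G ⊗[K] LieAlg (E := E) K G) : Prop :=
  ∀ a b : H, C.tensorPair r a b =
    f (b ⊗ₜ[K] a) - f (a ⊗ₜ[K] b) + C.tensorPair (symmPart r) a b

end TwistedCalculus

end CochainTwist

/-!
Convolution inversion gives `F⁻¹ = ε ⊗ ε - ħ f + O(ħ²)` (`IsCochain.coeff_one_inv`), so to first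
order in `ħ` the commutator of `m` and `n` is `(f - f₂₁)(m₁ ⊗ n₁) m₂ n₂ - m₁ n₁ (f - f₂₁)(m₂ ⊗
n₂)`, and the hypothesis on `f` says precisely that `f₂₁ - f` is the functional given by `r₋`
(`apply_twistedMul_commutator`, `ClassicalCalculus.sub_eq_pairBilin_skewPart`). Evaluated at a
point, `a₁ ⊗ da₂(e)` and `da₁(e) ⊗ a₂` are the derivatives of `a` along left and right invariant
vector fields, and the coactions on forms give, up to a sign, the infinitesimal actions on 1-forms
in the same way. For functions this yields `{a, b}`, since skewness of the Poisson bivector allows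
`r` to be replaced by `r₋` in it; for forms it yields the formula in terms of the infinitesimal
actions.

To compare the latter with the canonical preconnection, fix `w = g v`. The right invariant
derivatives of `x ↦ τ̃(x)(v)` at `g` are, up to sign, the infinitesimal left action. The left
invariant ones differ from the negated infinitesimal right action because `v` is moved by left
instead of right translations, and the difference in the direction `u` is `τ̃(g)([v, u])`
(`ClassicalCalculus.neg_formRightAct_eq`), which is the coadjoint term. For `τ = db` this rests on
two facts: left and right invariant derivatives commute, which for functions in `H` is visible
from the coproduct, and the commutator of left invariant derivatives is the derivative along the
Lie bracket, which is deduced from its analogue in a vector space by working in a chart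
(`mfderiv_apply_mlieBracket`).
-/

namespace CochainTwist

/-! ### Inverting a twist to first order -/

section Inverse

variable {K H : Type*} [Field K] [CommRing H] [HopfAlgebra K H]

/-- The coefficients of a convolution product are given by the Cauchy product formula. -/
theorem hbarCoeff_mul (n : ℕ) (F G : WithConv (H ⊗[K] H →ₗ[K] PowerSeries K)) :
    WithConv.toConv (hbarCoeff n (F * G)) = ∑ p ∈ Finset.HasAntidiagonal.antidiagonal n,
      WithConv.toConv (hbarCoeff p.1 F) * WithConv.toConv (hbarCoeff p.2 G) := by
  have key : ∀ t : (H ⊗[K] H) ⊗[K] (H ⊗[K] H),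
      PowerSeries.coeff n (LinearMap.mul' K (PowerSeries K)
        (TensorProduct.map F.ofConv G.ofConv t)) =
      ∑ p ∈ Finset.HasAntidiagonal.antidiagonal n, LinearMap.mul' K K
        (TensorProduct.map (hbarCoeff p.1 F) (hbarCoeff p.2 G) t) := by
    intro t
    induction t with
    | zero => simp
    | add x y hx hy => simp only [map_add, hx, hy, Finset.sum_add_distrib]
    | tmul x y => simp [hbarCoeff, PowerSeries.coeff_mul]
  apply WithConv.ofConv_injective
  rw [WithConv.ofConv_sum]
  refine LinearMap.ext fun c => ?_
  rw [LinearMap.sum_apply]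
  exact key _

theorem hbarCoeff_one (n : ℕ) :
    WithConv.toConv (hbarCoeff n (1 : WithConv (H ⊗[K] H →ₗ[K] PowerSeries K))) =
      if n = 0 then 1 else 0 := by
  apply WithConv.ofConv_injective
  refine LinearMap.ext fun c => ?_
  have h : hbarCoeff n (1 : WithConv (H ⊗[K] H →ₗ[K] PowerSeries K)) c =
      if n = 0 then Coalgebra.counit (R := K) c else 0 := by
    change PowerSeries.coeff n
      (algebraMap K (PowerSeries K) (Coalgebra.counit (R := K) c)) = _
    rw [PowerSeries.algebraMap_apply, Algebra.algebraMap_self, RingHom.id_apply,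
      PowerSeries.coeff_C]
  refine h.trans ?_
  split_ifs <;> rfl

variable {F : InvFunctional K H} {f : H ⊗[K] H →ₗ[K] K}

theorem IsCochain.toConv_coeff_zero (hF : IsCochain F f) :
    WithConv.toConv (hbarCoeff 0 F.val) = 1 := by
  rw [hF.coeff_zero]
  rfl

theorem IsCochain.coeff_zero_inv (hF : IsCochain F f) :
    hbarCoeff 0 F⁻¹.val = Coalgebra.counit (R := K) (A := H ⊗[K] H) := by
  have h := hbarCoeff_mul 0 F.val F⁻¹.val
  rw [F.mul_inv, hbarCoeff_one, Finset.Nat.antidiagonal_zero, Finset.sum_singleton,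
    hF.toConv_coeff_zero, one_mul, if_pos rfl] at h
  exact (congrArg WithConv.ofConv h).symm

theorem IsCochain.coeff_one_inv (hF : IsCochain F f) : hbarCoeff 1 F⁻¹.val = -f := by
  have h := hbarCoeff_mul 1 F.val F⁻¹.val
  have h0 : WithConv.toConv (hbarCoeff 0 F⁻¹.val) = 1 := by
    rw [hF.coeff_zero_inv]
    rfl
  rw [F.mul_inv, hbarCoeff_one, Finset.Nat.sum_antidiagonal_succ, Finset.Nat.antidiagonal_zero,
    Finset.sum_singleton, zero_add, hF.toConv_coeff_zero, one_mul, if_neg one_ne_zero] at h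
  have h' : WithConv.toConv (hbarCoeff 1 F⁻¹.val) +
      WithConv.toConv (hbarCoeff 1 F.val) = 0 := by
    simpa [h0] using h.symm
  rw [hF.coeff_one] at h'
  exact congrArg WithConv.ofConv (eq_neg_of_add_eq_zero_left h')

end Inverse

/-! ### The first order term of a twisted product -/

section FirstOrder

variable {K H : Type*} [Field K] [CommRing H] [HopfAlgebra K H]
  {M N P V : Type*} [AddCommGroup M] [Module K M] [AddCommGroup N] [Module K N]
  [AddCommGroup P] [Module K P] [AddCommGroup V] [Module K V]

@[simp]
theorem twistTerm_tmul (Φ Ψ : H ⊗[K] H →ₗ[K] K) (μ : M →ₗ[K] N →ₗ[K] P)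
    (h h' k k' : H) (m : M) (n : N) :
    twistTerm Φ Ψ μ (h ⊗ₜ (m ⊗ₜ h')) (k ⊗ₜ (n ⊗ₜ k')) =
      Φ (h ⊗ₜ k) • Ψ (h' ⊗ₜ k') • μ m n := by
  simp [twistTerm]

variable (K H M) in
/-- `h ⊗ m ⊗ h' ↦ ε(h') h ⊗ m`. -/
def trimRight : H ⊗[K] (M ⊗[K] H) →ₗ[K] H ⊗[K] M :=
  LinearMap.lTensor H ((TensorProduct.rid K M).toLinearMap ∘ₗ
    LinearMap.lTensor M (Coalgebra.counit (R := K)))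

variable (K H M) in
/-- `h ⊗ m ⊗ h' ↦ ε(h) m ⊗ h'`. -/
def trimLeft : H ⊗[K] (M ⊗[K] H) →ₗ[K] M ⊗[K] H :=
  (TensorProduct.lid K (M ⊗[K] H)).toLinearMap ∘ₗ
    LinearMap.rTensor (M ⊗[K] H) (Coalgebra.counit (R := K))

variable (K H M) in
/-- `h ⊗ m ↦ ε(h) m`. -/
def counitLeft : H ⊗[K] M →ₗ[K] M :=
  (TensorProduct.lid K M).toLinearMap ∘ₗ LinearMap.rTensor M (Coalgebra.counit (R := K))

/-- `h ⊗ m ↦ α(m) D(h)`. -/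
def contractRight (D : H →ₗ[K] V) (α : M →ₗ[K] K) : H ⊗[K] M →ₗ[K] V :=
  (TensorProduct.rid K V).toLinearMap ∘ₗ TensorProduct.map D α

/-- `m ⊗ h ↦ α(m) D(h)`. -/
def contractLeft (D : H →ₗ[K] V) (α : M →ₗ[K] K) : M ⊗[K] H →ₗ[K] V :=
  (TensorProduct.lid K V).toLinearMap ∘ₗ TensorProduct.map α D

@[simp]
theorem contractRight_tmul (D : H →ₗ[K] V) (α : M →ₗ[K] K) (h : H) (m : M) :
    contractRight D α (h ⊗ₜ m) = α m • D h := by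
  simp [contractRight]

@[simp]
theorem contractLeft_tmul (D : H →ₗ[K] V) (α : M →ₗ[K] K) (h : H) (m : M) :
    contractLeft D α (m ⊗ₜ h) = α m • D h := by
  simp [contractLeft]

@[simp]
theorem trimRight_tmul (h h' : H) (m : M) :
    trimRight K H M (h ⊗ₜ (m ⊗ₜ h')) = Coalgebra.counit (R := K) h' • (h ⊗ₜ m) := by
  simp [trimRight]

@[simp]
theorem trimLeft_tmul (h h' : H) (m : M) :
    trimLeft K H M (h ⊗ₜ (m ⊗ₜ h')) = Coalgebra.counit (R := K) h • (m ⊗ₜ h') := by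
  simp [trimLeft]

@[simp]
theorem counitLeft_tmul (h : H) (m : M) :
    counitLeft K H M (h ⊗ₜ m) = Coalgebra.counit (R := K) h • m := by
  simp [counitLeft]

/-- Linear maps out of `H ⊗ (M ⊗ H)` in two arguments agree if they agree on pure tensors. -/
theorem bilin_ext_tensor₃ {Q : Type*} [AddCommGroup Q] [Module K Q]
    {S T : H ⊗[K] (M ⊗[K] H) →ₗ[K] H ⊗[K] (N ⊗[K] H) →ₗ[K] Q}
    (h : ∀ (a : H) (m : M) (a' b : H) (n : N) (b' : H),
      S (a ⊗ₜ (m ⊗ₜ a')) (b ⊗ₜ (n ⊗ₜ b')) = T (a ⊗ₜ (m ⊗ₜ a')) (b ⊗ₜ (n ⊗ₜ b'))) : S = T := by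
  ext a m a' b n b'
  exact h a m a' b n b'

theorem twistTerm_counit_counit (μ : M →ₗ[K] N →ₗ[K] P) (X : H ⊗[K] (M ⊗[K] H))
    (Y : H ⊗[K] (N ⊗[K] H)) :
    twistTerm (Coalgebra.counit (R := K)) (Coalgebra.counit (R := K)) μ X Y =
      μ (counitLeft K H M (trimRight K H M X)) (counitLeft K H N (trimRight K H N Y)) := by
  suffices h : twistTerm (Coalgebra.counit (R := K)) (Coalgebra.counit (R := K)) μ =
      μ.compl₁₂ (counitLeft K H M ∘ₗ trimRight K H M) (counitLeft K H N ∘ₗ trimRight K H N) by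
    rw [h]; rfl
  refine bilin_ext_tensor₃ fun a m a' b n b' => ?_
  simp only [twistTerm_tmul, TensorProduct.counit_tmul, LinearMap.compl₁₂_apply,
    LinearMap.comp_apply, trimRight_tmul, map_smul, counitLeft_tmul, LinearMap.smul_apply,
    smul_smul, smul_eq_mul]
  congr 1
  ring

/-- Applying a functional to a twist term in which the right-hand factor is trivial. -/
theorem apply_twistTerm_counit_right {Φ : H ⊗[K] H →ₗ[K] K} {μ : M →ₗ[K] N →ₗ[K] P}
    {B : V →ₗ[K] V →ₗ[K] K} {D : H →ₗ[K] V} (hΦ : ∀ h k, Φ (h ⊗ₜ k) = B (D h) (D k))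
    {ℓ : P →ₗ[K] K} {α : M →ₗ[K] K} {β : N →ₗ[K] K} (hℓ : ∀ m n, ℓ (μ m n) = α m * β n)
    (X : H ⊗[K] (M ⊗[K] H)) (Y : H ⊗[K] (N ⊗[K] H)) :
    ℓ (twistTerm Φ (Coalgebra.counit (R := K)) μ X Y) =
      B (contractRight D α (trimRight K H M X)) (contractRight D β (trimRight K H N Y)) := by
  suffices h : (twistTerm Φ (Coalgebra.counit (R := K)) μ).compr₂ ℓ =
      B.compl₁₂ (contractRight D α ∘ₗ trimRight K H M) (contractRight D β ∘ₗ trimRight K H N) from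
    LinearMap.congr_fun (LinearMap.congr_fun h X) Y
  refine bilin_ext_tensor₃ fun a m a' b n b' => ?_
  simp only [LinearMap.compr₂_apply, twistTerm_tmul, TensorProduct.counit_tmul,
    LinearMap.compl₁₂_apply, LinearMap.comp_apply, trimRight_tmul, map_smul, contractRight_tmul,
    LinearMap.smul_apply, smul_eq_mul, hΦ, hℓ]
  ring

/-- Applying a functional to a twist term in which the left-hand factor is trivial. -/
theorem apply_twistTerm_counit_left {Φ : H ⊗[K] H →ₗ[K] K} {μ : M →ₗ[K] N →ₗ[K] P}
    {B : V →ₗ[K] V →ₗ[K] K} {D : H →ₗ[K] V} (hΦ : ∀ h k, Φ (h ⊗ₜ k) = B (D h) (D k))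
    {ℓ : P →ₗ[K] K} {α : M →ₗ[K] K} {β : N →ₗ[K] K} (hℓ : ∀ m n, ℓ (μ m n) = α m * β n)
    (X : H ⊗[K] (M ⊗[K] H)) (Y : H ⊗[K] (N ⊗[K] H)) :
    ℓ (twistTerm (Coalgebra.counit (R := K)) Φ μ X Y) =
      B (contractLeft D α (trimLeft K H M X)) (contractLeft D β (trimLeft K H N Y)) := by
  suffices h : (twistTerm (Coalgebra.counit (R := K)) Φ μ).compr₂ ℓ =
      B.compl₁₂ (contractLeft D α ∘ₗ trimLeft K H M) (contractLeft D β ∘ₗ trimLeft K H N) from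
    LinearMap.congr_fun (LinearMap.congr_fun h X) Y
  refine bilin_ext_tensor₃ fun a m a' b n b' => ?_
  simp only [LinearMap.compr₂_apply, twistTerm_tmul, TensorProduct.counit_tmul,
    LinearMap.compl₁₂_apply, LinearMap.comp_apply, trimLeft_tmul, map_smul, contractLeft_tmul,
    LinearMap.smul_apply, smul_eq_mul, hΦ, hℓ]
  ring

variable {F : InvFunctional K H} {f : H ⊗[K] H →ₗ[K] K}

theorem twistedMul_zero (hF : IsCochain F f) (δM : M →ₗ[K] H ⊗[K] (M ⊗[K] H))
    (δN : N →ₗ[K] H ⊗[K] (N ⊗[K] H)) (μ : M →ₗ[K] N →ₗ[K] P) (m : M) (n : N) :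
    twistedMul F δM δN μ m n 0 =
      μ (counitLeft K H M (trimRight K H M (δM m))) (counitLeft K H N (trimRight K H N (δN n))) := by
  rw [twistedMul, Finset.Nat.antidiagonal_zero, Finset.sum_singleton, hF.coeff_zero,
    hF.coeff_zero_inv, twistTerm_counit_counit]

theorem twistedMul_one (hF : IsCochain F f) (δM : M →ₗ[K] H ⊗[K] (M ⊗[K] H))
    (δN : N →ₗ[K] H ⊗[K] (N ⊗[K] H)) (μ : M →ₗ[K] N →ₗ[K] P) (m : M) (n : N) :
    twistedMul F δM δN μ m n 1 =
      twistTerm f (Coalgebra.counit (R := K)) μ (δM m) (δN n) -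
        twistTerm (Coalgebra.counit (R := K)) f μ (δM m) (δN n) := by
  have hneg : twistTerm (Coalgebra.counit (R := K)) (-f) μ =
      -twistTerm (Coalgebra.counit (R := K)) f μ :=
    bilin_ext_tensor₃ fun a m a' b n b' => by simp
  rw [twistedMul, Finset.Nat.sum_antidiagonal_succ, Finset.Nat.antidiagonal_zero,
    Finset.sum_singleton, zero_add, hF.coeff_zero, hF.coeff_zero_inv, hF.coeff_one,
    hF.coeff_one_inv, hneg]
  simp only [LinearMap.neg_apply]
  abel

/-- If `f₂₁ - f` is a bilinear form `B` in the differentials `D` at the identity, then the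
coefficient of `ħ` in the commutator of a twisted product is `B` in the left invariant derivatives
`m₁ ⊗ D m₂` minus `B` in the right invariant derivatives `D m₁ ⊗ m₂`. -/
theorem apply_twistedMul_commutator (hF : IsCochain F f)
    {B : V →ₗ[K] V →ₗ[K] K} {D : H →ₗ[K] V}
    (hf : ∀ h k, f (k ⊗ₜ h) - f (h ⊗ₜ k) = B (D h) (D k))
    (δM : M →ₗ[K] H ⊗[K] (M ⊗[K] H)) (δN : N →ₗ[K] H ⊗[K] (N ⊗[K] H))
    {μ : M →ₗ[K] N →ₗ[K] P} {ℓ : P →ₗ[K] K} {α : M →ₗ[K] K} {β : N →ₗ[K] K}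
    (hℓ : ∀ m n, ℓ (μ m n) = α m * β n) (m : M) (n : N) :
    ℓ (twistedMul F δM δN μ m n 1 - twistedMul F δN δM μ.flip n m 1) =
      B (contractLeft D α (trimLeft K H M (δM m))) (contractLeft D β (trimLeft K H N (δN n))) -
      B (contractRight D α (trimRight K H M (δM m)))
        (contractRight D β (trimRight K H N (δN n))) := by
  set f₂₁ : H ⊗[K] H →ₗ[K] K := f ∘ₗ (TensorProduct.comm K H H).toLinearMap
  have hΦ : ∀ h k, (f₂₁ - f) (h ⊗ₜ[K] k) = B (D h) (D k) := fun h k => hf h k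
  rw [twistedMul_one hF, twistedMul_one hF, ← apply_twistTerm_counit_right hΦ hℓ,
    ← apply_twistTerm_counit_left hΦ hℓ, ← map_sub]
  have hr : twistTerm f (Coalgebra.counit (R := K)) μ.flip =
      (twistTerm f₂₁ (Coalgebra.counit (R := K)) μ).flip :=
    bilin_ext_tensor₃ fun a m a' b n b' => by
      simp [f₂₁, mul_comm]
  have hl : twistTerm (Coalgebra.counit (R := K)) f μ.flip =
      (twistTerm (Coalgebra.counit (R := K)) f₂₁ μ).flip :=
    bilin_ext_tensor₃ fun a m a' b n b' => by
      simp [f₂₁, mul_comm]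
  have hr' : twistTerm (f₂₁ - f) (Coalgebra.counit (R := K)) μ =
      twistTerm f₂₁ (Coalgebra.counit (R := K)) μ - twistTerm f (Coalgebra.counit (R := K)) μ :=
    bilin_ext_tensor₃ fun a m a' b n b' => by simp [sub_smul]
  have hl' : twistTerm (Coalgebra.counit (R := K)) (f₂₁ - f) μ =
      twistTerm (Coalgebra.counit (R := K)) f₂₁ μ - twistTerm (Coalgebra.counit (R := K)) f μ :=
    bilin_ext_tensor₃ fun a m a' b n b' => by simp [sub_smul, smul_sub]
  rw [hr, hl, hr', hl']
  simp only [LinearMap.flip_apply, LinearMap.sub_apply]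
  congr 1
  abel

theorem trimRight_comul₃ (a : H) : trimRight K H H (comul₃ K H a) = Coalgebra.comul a := by
  have h : ((TensorProduct.rid K H).toLinearMap ∘ₗ LinearMap.lTensor H (Coalgebra.counit (R := K)))
      ∘ₗ Coalgebra.comul = LinearMap.id := by
    ext x
    simp
  rw [trimRight, comul₃, LinearMap.comp_apply, ← LinearMap.comp_apply (LinearMap.lTensor H _),
    ← LinearMap.lTensor_comp, h, LinearMap.lTensor_id, LinearMap.id_apply]

theorem counitLeft_comul (a : H) : counitLeft K H H (Coalgebra.comul a) = a := by
  simp [counitLeft]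

/-- Applying a map to the right-hand factor commutes with the counit on the left-hand one. -/
theorem trimLeft_lTensor (δ : N →ₗ[K] M ⊗[K] H) (X : H ⊗[K] N) :
    trimLeft K H M (LinearMap.lTensor H δ X) = δ (counitLeft K H N X) := by
  induction X with
  | zero => simp
  | add x y hx hy => simp only [map_add, hx, hy]
  | tmul h n => simp [trimLeft]

theorem trimLeft_comul₃ (a : H) : trimLeft K H H (comul₃ K H a) = Coalgebra.comul a := by
  rw [comul₃, LinearMap.comp_apply, trimLeft_lTensor, counitLeft_comul]

end FirstOrder

/-! ### Pairing with a 2-tensor -/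

section Pairing

variable {K V : Type*} [Field K] [AddCommGroup V] [Module K V]

/-- `pair` as a bilinear form in its linear form arguments. -/
def pairBilin (t : V ⊗[K] V) : Module.Dual K V →ₗ[K] Module.Dual K V →ₗ[K] K :=
  LinearMap.mk₂ K (fun φ ψ => pair φ ψ t)
    (fun _ _ _ => by simp [pair, TensorProduct.map_add_left])
    (fun _ _ _ => by simp [pair, TensorProduct.map_smul_left])
    (fun _ _ _ => by simp [pair, TensorProduct.map_add_right])
    (fun _ _ _ => by simp [pair, TensorProduct.map_smul_right])

@[simp]
theorem pairBilin_apply (t : V ⊗[K] V) (φ ψ : Module.Dual K V) :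
    pairBilin t φ ψ = pair φ ψ t := rfl

theorem pair_comm (φ ψ : Module.Dual K V) (t : V ⊗[K] V) :
    pair φ ψ (TensorProduct.comm K V V t) = pair ψ φ t := by
  induction t with
  | zero => simp [pair]
  | add x y hx hy => simpa [pair] using congrArg₂ (· + ·) hx hy
  | tmul x y => simp [pair, mul_comm]

theorem pair_symmPart (φ ψ : Module.Dual K V) (t : V ⊗[K] V) :
    pair φ ψ (symmPart t) = 2⁻¹ * (pair φ ψ t + pair ψ φ t) := by
  rw [← pair_comm φ ψ]
  simp [pair, symmPart, mul_add]

theorem pair_skewPart (φ ψ : Module.Dual K V) (t : V ⊗[K] V) :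
    pair φ ψ (skewPart t) = 2⁻¹ * (pair φ ψ t - pair ψ φ t) := by
  rw [← pair_comm φ ψ]
  simp [pair, skewPart]

end Pairing

end CochainTwist

namespace CochainTwist

/-! ### Differentiating smooth functions at the identity -/

section DiffOne

variable {E : Type*} [NormedAddCommGroup E] [NormedSpace ℝ E] {K : Type*} [RCLike K]
  {G : Type*} [TopologicalSpace G] [ChartedSpace E G] [Group G]

/-- The derivative of `b` at the identity along the real tangent vector `v`. -/
def diffOneReal (b : G → K) (v : GroupLieAlgebra 𝓘(ℝ, E) G) : K :=
  mfderiv 𝓘(ℝ, E) 𝓘(ℝ, K) b (1 : G) v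

theorem diffOne_tmul (b : G → K) (c : K) (v : GroupLieAlgebra 𝓘(ℝ, E) G) :
    diffOne b (c ⊗ₜ[ℝ] v) = c * diffOneReal b v := rfl

/-- Linear forms on the extended Lie algebra are determined by the real tangent vectors. -/
theorem dual_ext {φ ψ : Module.Dual K (LieAlg (E := E) K G)}
    (h : ∀ v : GroupLieAlgebra 𝓘(ℝ, E) G, φ ((1 : K) ⊗ₜ[ℝ] v) = ψ ((1 : K) ⊗ₜ[ℝ] v)) : φ = ψ := by
  refine LinearMap.ext fun x => ?_
  induction x using TensorProduct.induction_on with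
  | zero => simp
  | add x y hx hy => rw [map_add, map_add, hx, hy]
  | tmul c v =>
    have hc : c ⊗ₜ[ℝ] v = c • ((1 : K) ⊗ₜ[ℝ] v : LieAlg (E := E) K G) := by
      rw [TensorProduct.smul_tmul', smul_eq_mul, mul_one]
    rw [hc, map_smul, map_smul, h]

theorem diffOne_ext {b : G → K} {ψ : Module.Dual K (LieAlg (E := E) K G)}
    (h : ∀ v : GroupLieAlgebra 𝓘(ℝ, E) G, diffOneReal b v = ψ ((1 : K) ⊗ₜ[ℝ] v)) :
    diffOne b = ψ :=
  dual_ext fun v => by rw [diffOne_tmul, one_mul, h]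

variable {b b' : G → K}

theorem diffOne_const (c : K) : diffOne (E := E) (fun _ : G => c) = 0 :=
  diffOne_ext fun v => by
    change (mfderiv 𝓘(ℝ, E) 𝓘(ℝ, K) (fun _ : G => c) 1) v = _
    rw [mfderiv_const]
    rfl

theorem diffOne_add (hb : MDifferentiableAt 𝓘(ℝ, E) 𝓘(ℝ, K) b 1)
    (hb' : MDifferentiableAt 𝓘(ℝ, E) 𝓘(ℝ, K) b' 1) :
    diffOne (E := E) (fun x => b x + b' x) = diffOne b + diffOne b' :=
  diffOne_ext fun v => by
    rw [LinearMap.add_apply, diffOne_tmul, diffOne_tmul, one_mul, one_mul]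
    exact DFunLike.congr_fun (mfderiv_add hb hb') v

theorem diffOne_mul (hb : MDifferentiableAt 𝓘(ℝ, E) 𝓘(ℝ, K) b 1)
    (hb' : MDifferentiableAt 𝓘(ℝ, E) 𝓘(ℝ, K) b' 1) :
    diffOne (E := E) (fun x => b x * b' x) = b 1 • diffOne b' + b' 1 • diffOne b :=
  diffOne_ext fun v => by
    rw [LinearMap.add_apply, LinearMap.smul_apply, LinearMap.smul_apply, diffOne_tmul, diffOne_tmul,
      one_mul, one_mul]
    exact DFunLike.congr_fun (hb.hasMFDerivAt.mul hb'.hasMFDerivAt).mfderiv v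

theorem diffOne_const_mul (c : K) (hb : MDifferentiableAt 𝓘(ℝ, E) 𝓘(ℝ, K) b 1) :
    diffOne (E := E) (fun x => c * b x) = c • diffOne b := by
  rw [diffOne_mul mdifferentiableAt_const hb, diffOne_const, smul_zero, add_zero]

omit [Group G] in
/-- A 1-form may be evaluated at a point that is only propositionally equal to the given one, all
tangent spaces being the model space `E`. -/
theorem form_congr_point (τ : Form (E := E) K G) {x y : G} (h : x = y) (e : E) :
    (show E →L[ℝ] K from τ x) e = (show E →L[ℝ] K from τ y) e := by
  subst h
  rfl

omit [Group G] in
theorem mfderiv_apply_of_eq_id {f : G → G} (hf : f = id) {g : G} (w : E) :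
    (show E →L[ℝ] E from mfderiv 𝓘(ℝ, E) 𝓘(ℝ, E) f g) w = w := by
  subst hf
  rw [mfderiv_id]
  rfl

end DiffOne

/-! ### The coactions of a classical calculus -/

namespace ClassicalCalculus

section Coaction

variable {E : Type*} [NormedAddCommGroup E] [NormedSpace ℝ E] {K : Type*} [RCLike K]
  {G : Type*} [TopologicalSpace G] [ChartedSpace E G] [Group G]
  {H : Type*} [CommRing H] [HopfAlgebra K H]
  {Γ : Type*} [AddCommGroup Γ] [Module K Γ] [Module H Γ]
  {M : Type*} [AddCommGroup M] [Module K M]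

variable (C : ClassicalCalculus E K G H Γ)

theorem mdifferentiable (a : H) : MDifferentiable 𝓘(ℝ, E) 𝓘(ℝ, K) (C.fn a) :=
  (C.fn_smooth a).mdifferentiable (by simp)

/-- Evaluation of functions at a point. -/
def evalFn (g : G) : H →ₗ[K] K := LinearMap.proj g ∘ₗ C.fn.toLinearMap

@[simp]
theorem evalFn_apply (g : G) (a : H) : C.evalFn g a = C.fn a g := rfl

/-- Evaluation of 1-forms on a tangent vector. -/
def evalFormAt (g : G) (w : TangentSpace 𝓘(ℝ, E) g) : Γ →ₗ[K] K := evalForm g w ∘ₗ C.form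

/-- The differential at the identity, as a map from `H` to the dual of the Lie algebra. -/
def diff : H →ₗ[K] Module.Dual K (LieAlg (E := E) K G) where
  toFun a := diffOne (C.fn a)
  map_add' a b := by
    rw [map_add]
    exact diffOne_add (C.mdifferentiable a 1) (C.mdifferentiable b 1)
  map_smul' c a := by
    rw [map_smul]
    exact diffOne_const_mul c (C.mdifferentiable a 1)

@[simp]
theorem diff_apply (a : H) : C.diff a = diffOne (C.fn a) := rfl

/-- The function on `G` represented by an element of `H ⊗ M` and a functional on `M` is smooth, and
its differential at the identity is the contraction with `C.diff`. -/
theorem smooth_and_diffOne_contractRight (α : M →ₗ[K] K) (X : H ⊗[K] M) :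
    ContMDiff 𝓘(ℝ, E) 𝓘(ℝ, K) ∞
      (fun x => LinearMap.mul' K K (TensorProduct.map (C.evalFn x) α X)) ∧
    diffOne (fun x => LinearMap.mul' K K (TensorProduct.map (C.evalFn x) α X)) =
      contractRight C.diff α X := by
  induction X using TensorProduct.induction_on with
  | zero =>
    simp only [map_zero]
    exact ⟨contMDiff_const, diffOne_const 0⟩
  | add X Y hX hY =>
    simp only [map_add]
    refine ⟨hX.1.add hY.1, ?_⟩
    rw [diffOne_add (hX.1.mdifferentiable (by simp) 1) (hY.1.mdifferentiable (by simp) 1),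
      hX.2, hY.2]
  | tmul h m =>
    simp only [TensorProduct.map_tmul, LinearMap.mul'_apply, evalFn_apply, mul_comm _ (α m),
      contractRight_tmul, diff_apply]
    exact ⟨(ContinuousLinearMap.mul ℝ K (α m)).contDiff.contMDiff.comp (C.fn_smooth h),
      diffOne_const_mul _ (C.mdifferentiable h 1)⟩

theorem mul'_map_comm {P Q : Type*} [AddCommGroup P] [Module K P] [AddCommGroup Q] [Module K Q]
    (α : P →ₗ[K] K) (β : Q →ₗ[K] K) (X : P ⊗[K] Q) :
    LinearMap.mul' K K (TensorProduct.map α β X) =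
      LinearMap.mul' K K (TensorProduct.map β α (TensorProduct.comm K P Q X)) := by
  induction X with
  | zero => simp
  | add X Y hX hY => simp only [map_add, hX, hY]
  | tmul p q => simp [mul_comm]

theorem contractRight_comm (D : H →ₗ[K] Module.Dual K (LieAlg (E := E) K G)) (α : M →ₗ[K] K)
    (X : M ⊗[K] H) :
    contractRight D α (TensorProduct.comm K M H X) = contractLeft D α X := by
  induction X with
  | zero => simp
  | add X Y hX hY => simp only [map_add, hX, hY]
  | tmul m h => simp

/-- Mirror image of `smooth_and_diffOne_contractRight`. -/
theorem smooth_and_diffOne_contractLeft (α : M →ₗ[K] K) (X : M ⊗[K] H) :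
    ContMDiff 𝓘(ℝ, E) 𝓘(ℝ, K) ∞
      (fun x => LinearMap.mul' K K (TensorProduct.map α (C.evalFn x) X)) ∧
    diffOne (fun x => LinearMap.mul' K K (TensorProduct.map α (C.evalFn x) X)) =
      contractLeft C.diff α X := by
  simp only [mul'_map_comm α, ← contractRight_comm]
  exact C.smooth_and_diffOne_contractRight α _

theorem contractRight_comul (a : H) (g : G) :
    contractRight C.diff (C.evalFn g) (Coalgebra.comul a) = derivR (C.fn a) g := by
  rw [← (C.smooth_and_diffOne_contractRight _ _).2]
  exact congrArg diffOne (funext fun x => C.fn_comul a x g)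

theorem contractLeft_comul (a : H) (g : G) :
    contractLeft C.diff (C.evalFn g) (Coalgebra.comul a) = derivL (C.fn a) g := by
  rw [← (C.smooth_and_diffOne_contractLeft _ _).2]
  exact congrArg diffOne (funext fun x => C.fn_comul a g x)

theorem contractRight_coactL (τ : Γ) (g : G) (w : TangentSpace 𝓘(ℝ, E) g) :
    contractRight C.diff (C.evalFormAt g w) (C.coactL τ) = -formLeftAct (C.form τ) g w := by
  rw [← (C.smooth_and_diffOne_contractRight _ _).2, formLeftAct, neg_neg]
  exact congrArg diffOne (funext fun x => C.coactL_apply τ x g w)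

theorem contractLeft_coactR (τ : Γ) (g : G) (w : TangentSpace 𝓘(ℝ, E) g) :
    contractLeft C.diff (C.evalFormAt g w) (C.coactR τ) = -formRightAct (C.form τ) g w := by
  rw [← (C.smooth_and_diffOne_contractLeft _ _).2, formRightAct, neg_neg]
  exact congrArg diffOne (funext fun x => C.coactR_apply τ x g w)

theorem form_ext {σ τ : Γ} (h : ∀ (g : G) (w : TangentSpace 𝓘(ℝ, E) g),
    C.form σ g w = C.form τ g w) : σ = τ :=
  C.form_injective (funext fun g => ContinuousLinearMap.ext (h g))

/-- The left-hand counit axiom of the calculus. -/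
theorem counitLeft_coactL (τ : Γ) : counitLeft K H Γ (C.coactL τ) = τ := by
  refine C.form_ext fun g w => ?_
  have h : ∀ X : H ⊗[K] Γ, C.evalFormAt g w (counitLeft K H Γ X) =
      LinearMap.mul' K K (TensorProduct.map (C.evalFn 1) (C.evalFormAt g w) X) := by
    intro X
    induction X with
    | zero => simp
    | add X Y hX hY => simp only [map_add, hX, hY]
    | tmul a σ =>
      simp only [counitLeft_tmul, map_smul, C.fn_counit, TensorProduct.map_tmul,
        LinearMap.mul'_apply, evalFn_apply, smul_eq_mul]
  refine (h _).trans ((C.coactL_apply τ 1 g w).trans ?_)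
  refine (form_congr_point (E := E) _ (one_mul g) _).trans ?_
  exact congrArg (show E →L[ℝ] K from C.form τ g)
    (mfderiv_apply_of_eq_id (E := E) (funext one_mul) w)

/-- The right-hand counit axiom of the calculus. -/
theorem rid_lTensor_counit_coactR (τ : Γ) :
    TensorProduct.rid K Γ (LinearMap.lTensor Γ (Coalgebra.counit (R := K)) (C.coactR τ)) = τ := by
  refine C.form_ext fun g w => ?_
  have h : ∀ X : Γ ⊗[K] H, C.evalFormAt g w
      (TensorProduct.rid K Γ (LinearMap.lTensor Γ (Coalgebra.counit (R := K)) X)) =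
      LinearMap.mul' K K (TensorProduct.map (C.evalFormAt g w) (C.evalFn 1) X) := by
    intro X
    induction X with
    | zero => simp
    | add X Y hX hY => simp only [map_add, hX, hY]
    | tmul σ a =>
      simp only [LinearMap.lTensor_tmul, TensorProduct.rid_tmul, map_smul, C.fn_counit,
        TensorProduct.map_tmul, LinearMap.mul'_apply, evalFn_apply, smul_eq_mul, mul_comm]
  refine (h _).trans ((C.coactR_apply τ 1 g w).trans ?_)
  refine (form_congr_point (E := E) _ (mul_one g) _).trans ?_
  exact congrArg (show E →L[ℝ] K from C.form τ g)
    (mfderiv_apply_of_eq_id (E := E) (funext mul_one) w)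

theorem trimLeft_coact₃ (τ : Γ) : trimLeft K H Γ (C.coact₃ τ) = C.coactR τ := by
  rw [coact₃, LinearMap.comp_apply, trimLeft_lTensor, counitLeft_coactL]

theorem trimRight_coact₃ (τ : Γ) : trimRight K H Γ (C.coact₃ τ) = C.coactL τ := by
  have h : ((TensorProduct.rid K Γ).toLinearMap ∘ₗ LinearMap.lTensor Γ (Coalgebra.counit (R := K)))
      ∘ₗ C.coactR = LinearMap.id :=
    LinearMap.ext C.rid_lTensor_counit_coactR
  rw [trimRight, coact₃, LinearMap.comp_apply, ← LinearMap.comp_apply (LinearMap.lTensor H _),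
    ← LinearMap.lTensor_comp, h, LinearMap.lTensor_id, LinearMap.id_apply]

end Coaction

end ClassicalCalculus

end CochainTwist

namespace CochainTwist

/-! ### Lie brackets as commutators of derivations -/

section LieBracket

variable {E : Type*} [NormedAddCommGroup E] [NormedSpace ℝ E]
  {F : Type*} [NormedAddCommGroup F] [NormedSpace ℝ F]
  {M : Type*} [TopologicalSpace M] [ChartedSpace E M] [IsManifold 𝓘(ℝ, E) ∞ M]

open VectorField

/-- The derivative of `f` along `V`, read in a chart, is the derivative of the coordinate
expression of `f` along the coordinate expression of `V`. -/
theorem fderiv_comp_extChartAt_symm_apply_mpullbackWithin {f : M → F}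
    (V : Π x : M, TangentSpace 𝓘(ℝ, E) x) {x : M} {y : E}
    (hy : y ∈ (extChartAt 𝓘(ℝ, E) x).target)
    (hf : MDifferentiableAt 𝓘(ℝ, E) 𝓘(ℝ, F) f ((extChartAt 𝓘(ℝ, E) x).symm y)) :
    fderiv ℝ (f ∘ (extChartAt 𝓘(ℝ, E) x).symm) y
        (mpullbackWithin 𝓘(ℝ, E) 𝓘(ℝ, E) (extChartAt 𝓘(ℝ, E) x).symm V
          (Set.range 𝓘(ℝ, E)) y) =
      (mfderiv 𝓘(ℝ, E) 𝓘(ℝ, F) f ((extChartAt 𝓘(ℝ, E) x).symm y)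
        (V ((extChartAt 𝓘(ℝ, E) x).symm y)) : F) := by
  have hinv := isInvertible_mfderivWithin_extChartAt_symm (I := 𝓘(ℝ, E)) hy
  have hd : MDifferentiableWithinAt 𝓘(ℝ, E) 𝓘(ℝ, E) (extChartAt 𝓘(ℝ, E) x).symm
      (Set.range 𝓘(ℝ, E)) y := mdifferentiableWithinAt_extChartAt_symm hy
  have hd' : MDifferentiableAt 𝓘(ℝ, E) 𝓘(ℝ, E) (extChartAt 𝓘(ℝ, E) x).symm y := by
    simpa [mdifferentiableWithinAt_univ] using hd
  rw [← mfderiv_eq_fderiv, mfderiv_comp y hf hd']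
  rw [mpullbackWithin_apply]
  have hw : mfderivWithin 𝓘(ℝ, E) 𝓘(ℝ, E) (extChartAt 𝓘(ℝ, E) x).symm (Set.range 𝓘(ℝ, E)) y =
      mfderiv 𝓘(ℝ, E) 𝓘(ℝ, E) (extChartAt 𝓘(ℝ, E) x).symm y := by
    rw [ModelWithCorners.range_eq_univ, mfderivWithin_univ]
  rw [hw] at hinv ⊢
  refine congrArg (mfderiv 𝓘(ℝ, E) 𝓘(ℝ, F) f ((extChartAt 𝓘(ℝ, E) x).symm y)) ?_
  exact hinv.self_apply_inverse _

/-- The derivative along `[V, W]` is the commutator of the derivatives along `V` and `W`. -/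
theorem mfderiv_apply_mlieBracket [CompleteSpace E] {f : M → F} (hf : ContMDiff 𝓘(ℝ, E) 𝓘(ℝ, F) ∞ f)
    {V W : Π x : M, TangentSpace 𝓘(ℝ, E) x} {x : M}
    (hV : MDifferentiableAt 𝓘(ℝ, E) 𝓘(ℝ, E).tangent (fun y => (V y : TangentBundle 𝓘(ℝ, E) M)) x)
    (hW : MDifferentiableAt 𝓘(ℝ, E) 𝓘(ℝ, E).tangent (fun y => (W y : TangentBundle 𝓘(ℝ, E) M)) x)
    {fV fW : M → F} (hfV : ∀ y, fV y = mfderiv 𝓘(ℝ, E) 𝓘(ℝ, F) f y (V y))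
    (hfW : ∀ y, fW y = mfderiv 𝓘(ℝ, E) 𝓘(ℝ, F) f y (W y))
    (hdV : MDifferentiableAt 𝓘(ℝ, E) 𝓘(ℝ, F) fV x)
    (hdW : MDifferentiableAt 𝓘(ℝ, E) 𝓘(ℝ, F) fW x) :
    (show F from mfderiv 𝓘(ℝ, E) 𝓘(ℝ, F) f x (mlieBracket 𝓘(ℝ, E) V W x)) =
      (show F from mfderiv 𝓘(ℝ, E) 𝓘(ℝ, F) fW x (V x)) -
        (show F from mfderiv 𝓘(ℝ, E) 𝓘(ℝ, F) fV x (W x)) := by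
  have hfd : MDifferentiable 𝓘(ℝ, E) 𝓘(ℝ, F) f := hf.mdifferentiable (by simp)
  have : IsManifold 𝓘(ℝ, E) 2 M := IsManifold.of_le (n := ∞) ENat.LEInfty.out
  set φ := extChartAt 𝓘(ℝ, E) x
  have hx : φ x ∈ φ.target := mem_extChartAt_target x
  have hlx : φ.symm (φ x) = x := extChartAt_to_inv x
  set V' : E → E := mpullbackWithin 𝓘(ℝ, E) 𝓘(ℝ, E) φ.symm V (Set.range 𝓘(ℝ, E))
  set W' : E → E := mpullbackWithin 𝓘(ℝ, E) 𝓘(ℝ, E) φ.symm W (Set.range 𝓘(ℝ, E))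
  have hnhds : φ.target ∈ nhds (φ x) := extChartAt_target_mem_nhds x
  have hdsymm : MDifferentiableAt 𝓘(ℝ, E) 𝓘(ℝ, E) φ.symm (φ x) := by
    have h := mdifferentiableWithinAt_extChartAt_symm (I := 𝓘(ℝ, E)) hx
    rwa [ModelWithCorners.range_eq_univ, mdifferentiableWithinAt_univ] at h
  have hs : φ.symm ⁻¹' Set.univ ∩ Set.range 𝓘(ℝ, E) = Set.univ := by simp
  have hV'd : DifferentiableAt ℝ V' (φ x) := by
    have h := MDifferentiableWithinAt.differentiableWithinAt_mpullbackWithin_vectorField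
      (s := Set.univ) hV.mdifferentiableWithinAt
    rw [hs] at h
    exact differentiableWithinAt_univ.1 h
  have hW'd : DifferentiableAt ℝ W' (φ x) := by
    have h := MDifferentiableWithinAt.differentiableWithinAt_mpullbackWithin_vectorField
      (s := Set.univ) hW.mdifferentiableWithinAt
    rw [hs] at h
    exact differentiableWithinAt_univ.1 h
  have hf' : ContDiffAt ℝ 2 (f ∘ φ.symm) (φ x) := by
    have h := (hf.contMDiffAt (x := φ.symm (φ x))).comp (φ x)
      ((contMDiffOn_extChartAt_symm (n := ∞) x).contMDiffAt hnhds)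
    exact h.contDiffAt.of_le ENat.LEInfty.out
  have hbr := fderiv_apply_lieBracket hf' (by simp) hW'd hV'd
  have hcomm : ∀ {Z : Π x : M, TangentSpace 𝓘(ℝ, E) x} {fZ : M → F}
      (Y : Π x : M, TangentSpace 𝓘(ℝ, E) x),
      (∀ y, fZ y = mfderiv 𝓘(ℝ, E) 𝓘(ℝ, F) f y (Z y)) →
      MDifferentiableAt 𝓘(ℝ, E) 𝓘(ℝ, F) fZ x →
      fderiv ℝ (fun y => fderiv ℝ (f ∘ φ.symm) y
        (mpullbackWithin 𝓘(ℝ, E) 𝓘(ℝ, E) φ.symm Z (Set.range 𝓘(ℝ, E)) y)) (φ x)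
        (mpullbackWithin 𝓘(ℝ, E) 𝓘(ℝ, E) φ.symm Y (Set.range 𝓘(ℝ, E)) (φ x)) =
        (show F from mfderiv 𝓘(ℝ, E) 𝓘(ℝ, F) fZ x (Y x)) := by
    intro Z fZ Y hfZ hdZ
    have he : (fun y => fderiv ℝ (f ∘ φ.symm) y
        (mpullbackWithin 𝓘(ℝ, E) 𝓘(ℝ, E) φ.symm Z (Set.range 𝓘(ℝ, E)) y)) =ᶠ[nhds (φ x)]
        fZ ∘ φ.symm := by
      filter_upwards [hnhds] with y hy
      exact (fderiv_comp_extChartAt_symm_apply_mpullbackWithin Z hy (hfd _)).trans (hfZ _).symm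
    rw [he.fderiv_eq]
    refine (fderiv_comp_extChartAt_symm_apply_mpullbackWithin Y hx (by rwa [hlx])).trans ?_
    rw [hlx]
  rw [hcomm V hfW hdW, hcomm W hfV hdV] at hbr
  rw [← hbr, ← mfderiv_eq_fderiv, mfderiv_comp (φ x) (hfd _) hdsymm]
  -- It remains to identify the chart-wise bracket `L` with `[V, W]` under the derivative of `φ`.
  have hinv := isInvertible_mfderiv_extChartAt (I := 𝓘(ℝ, E))
    (mem_extChartAt_source (I := 𝓘(ℝ, E)) x)
  have hcompo := mfderivWithin_extChartAt_symm_comp_mfderiv_extChartAt' (I := 𝓘(ℝ, E))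
    (mem_extChartAt_source (I := 𝓘(ℝ, E)) x)
  rw [ModelWithCorners.range_eq_univ, mfderivWithin_univ] at hcompo
  set L : E := lieBracket ℝ V' W' (φ x)
  have hmL : mlieBracket 𝓘(ℝ, E) V W x = (mfderiv 𝓘(ℝ, E) 𝓘(ℝ, E) φ x).inverse L := by
    rw [← mlieBracketWithin_univ, mlieBracketWithin_apply, hs]
    exact congrArg (mfderiv 𝓘(ℝ, E) 𝓘(ℝ, E) φ x).inverse
      (congrFun (lieBracketWithin_univ (V := V') (W := W')) (φ x))
  have h1 : mfderiv 𝓘(ℝ, E) 𝓘(ℝ, E) φ x (mlieBracket 𝓘(ℝ, E) V W x) = L := by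
    rw [hmL]
    exact hinv.self_apply_inverse L
  have h2 : mfderiv 𝓘(ℝ, E) 𝓘(ℝ, E) φ.symm (φ x) L = mlieBracket 𝓘(ℝ, E) V W x := by
    rw [← h1]
    exact DFunLike.congr_fun hcompo _
  have h3 : ∀ y, y = x → ∀ u : E, (show F from mfderiv 𝓘(ℝ, E) 𝓘(ℝ, F) f y u) =
      (show F from mfderiv 𝓘(ℝ, E) 𝓘(ℝ, F) f x u) := by
    rintro y rfl u
    rfl
  refine ((h3 _ hlx _).trans ?_).symm
  exact congrArg (mfderiv 𝓘(ℝ, E) 𝓘(ℝ, F) f x) h2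

end LieBracket

end CochainTwist

namespace CochainTwist

/-! ### Invariant vector fields on a Lie group -/

section Translation

variable {E : Type*} [NormedAddCommGroup E] [NormedSpace ℝ E] {K : Type*} [RCLike K]
  {G : Type*} [TopologicalSpace G] [ChartedSpace E G] [Group G] [LieGroup 𝓘(ℝ, E) ∞ G]

theorem mdifferentiable_mul_left (g : G) : MDifferentiable 𝓘(ℝ, E) 𝓘(ℝ, E) (fun y : G => g * y) :=
  (contMDiff_mul_left (n := ∞)).mdifferentiable (by simp)

theorem mdifferentiable_mul_right (g : G) : MDifferentiable 𝓘(ℝ, E) 𝓘(ℝ, E) (fun y : G => y * g) :=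
  (contMDiff_mul_right (n := ∞)).mdifferentiable (by simp)

/-- The derivative of left translation by `x g` at the identity. -/
theorem mfderiv_mul_left_mul (x g : G) (v : GroupLieAlgebra 𝓘(ℝ, E) G) {w : TangentSpace 𝓘(ℝ, E) g}
    (hw : (show E from mfderiv 𝓘(ℝ, E) 𝓘(ℝ, E) (fun y : G => g * y) 1 v) = w) :
    (show E from mfderiv 𝓘(ℝ, E) 𝓘(ℝ, E) (fun y : G => x * g * y) 1 v) = transL x g w := by
  have h : (fun y : G => x * g * y) = (fun y => x * y) ∘ fun y => g * y :=
    funext fun y => mul_assoc x g y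
  rw [h]
  refine (mfderiv_comp_apply_of_eq _ (mdifferentiable_mul_left x g) (mdifferentiable_mul_left g 1)
    (mul_one g) v).trans ?_
  exact congrArg (show E →L[ℝ] E from mfderiv 𝓘(ℝ, E) 𝓘(ℝ, E) (fun y : G => x * y) g) hw

theorem mfderiv_mul_left_inv (g : G) (w : TangentSpace 𝓘(ℝ, E) g) :
    (show E from mfderiv 𝓘(ℝ, E) 𝓘(ℝ, E) (fun y : G => g * y) 1
      (show E from mfderiv 𝓘(ℝ, E) 𝓘(ℝ, E) (fun y : G => g⁻¹ * y) g w)) = w := by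
  have h : (fun y : G => g * y) ∘ (fun y => g⁻¹ * y) = id :=
    funext fun y => mul_inv_cancel_left g y
  have h' := mfderiv_apply_of_eq_id (E := E) h (g := g) w
  exact (mfderiv_comp_apply_of_eq _ (mdifferentiable_mul_left g 1) (mdifferentiable_mul_left g⁻¹ g)
    (inv_mul_cancel g) w).symm.trans h'

theorem derivL_tmul_eq_mulInvariantVectorField {f : G → K}
    (hf : MDifferentiable 𝓘(ℝ, E) 𝓘(ℝ, K) f) (v : GroupLieAlgebra 𝓘(ℝ, E) G) (x : G) :
    derivL f x ((1 : K) ⊗ₜ[ℝ] v) =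
      (show E →L[ℝ] K from mfderiv 𝓘(ℝ, E) 𝓘(ℝ, K) f x) (mulInvariantVectorField v x) := by
  rw [derivL, diffOne_tmul, one_mul]
  exact mfderiv_comp_apply_of_eq _ (hf x) (mdifferentiable_mul_left x 1) (mul_one x) v

omit [LieGroup 𝓘(ℝ, E) ∞ G] in
theorem mulInvariantVectorField_one (v : GroupLieAlgebra 𝓘(ℝ, E) G) :
    (show E from mulInvariantVectorField v 1) = v :=
  mfderiv_apply_of_eq_id (E := E) (funext one_mul) v

omit [LieGroup 𝓘(ℝ, E) ∞ G] in
theorem tilde_tmul (τ : Form (E := E) K G) (g : G) (v : GroupLieAlgebra 𝓘(ℝ, E) G) :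
    tilde τ g ((1 : K) ⊗ₜ[ℝ] v) =
      (show E →L[ℝ] K from τ g)
        (show E from mfderiv 𝓘(ℝ, E) 𝓘(ℝ, E) (fun y : G => g * y) 1 v) := by
  rw [tilde, LinearMap.liftBaseChange_tmul, one_smul]
  rfl

/-- The differential of `f` at the identity on a Lie bracket is the commutator of the derivatives
along the left invariant vector fields. -/
theorem diffOne_tmul_lie [CompleteSpace E] {f : G → K} (hf : ContMDiff 𝓘(ℝ, E) 𝓘(ℝ, K) ∞ f)
    (v u : GroupLieAlgebra 𝓘(ℝ, E) G)
    (hv : MDifferentiable 𝓘(ℝ, E) 𝓘(ℝ, K) fun x => derivL f x ((1 : K) ⊗ₜ[ℝ] v))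
    (hu : MDifferentiable 𝓘(ℝ, E) 𝓘(ℝ, K) fun x => derivL f x ((1 : K) ⊗ₜ[ℝ] u)) :
    diffOne f ((1 : K) ⊗ₜ[ℝ] ⁅v, u⁆) =
      diffOne (fun x => derivL f x ((1 : K) ⊗ₜ[ℝ] u)) ((1 : K) ⊗ₜ[ℝ] v) -
        diffOne (fun x => derivL f x ((1 : K) ⊗ₜ[ℝ] v)) ((1 : K) ⊗ₜ[ℝ] u) := by
  have hfd : MDifferentiable 𝓘(ℝ, E) 𝓘(ℝ, K) f := hf.mdifferentiable (by simp)
  simp only [diffOne_tmul, one_mul]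
  have h := mfderiv_apply_mlieBracket hf (x := (1 : G))
    (V := mulInvariantVectorField v) (W := mulInvariantVectorField u)
    (mdifferentiableAt_mulInvariantVectorField v) (mdifferentiableAt_mulInvariantVectorField u)
    (fun y => derivL_tmul_eq_mulInvariantVectorField hfd v y)
    (fun y => derivL_tmul_eq_mulInvariantVectorField hfd u y) (hv 1) (hu 1)
  refine h.trans (congrArg₂ (· - ·) ?_ ?_)
  · exact congrArg (show E →L[ℝ] K from mfderiv 𝓘(ℝ, E) 𝓘(ℝ, K) _ (1 : G))
      (mulInvariantVectorField_one v)
  · exact congrArg (show E →L[ℝ] K from mfderiv 𝓘(ℝ, E) 𝓘(ℝ, K) _ (1 : G))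
      (mulInvariantVectorField_one u)

end Translation

end CochainTwist

namespace CochainTwist

/-! ### Translating 1-forms from the two sides -/

namespace ClassicalCalculus

variable {E : Type*} [NormedAddCommGroup E] [NormedSpace ℝ E] {K : Type*} [RCLike K]
  {G : Type*} [TopologicalSpace G] [ChartedSpace E G] [Group G]
  {H : Type*} [CommRing H] [HopfAlgebra K H]
  {Γ : Type*} [AddCommGroup Γ] [Module K Γ] [Module H Γ]
  (C : ClassicalCalculus E K G H Γ)

/-- Left translates of elements of `H` are in `H`. -/
theorem exists_leftTranslate (g : G) (b : H) : ∃ B : H, ∀ y, C.fn B y = C.fn b (g * y) := by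
  have h : ∀ (X : H ⊗[K] H) (y : G),
      C.evalFn y (TensorProduct.lid K H (LinearMap.rTensor H (C.evalFn g) X)) =
        LinearMap.mul' K K (TensorProduct.map (C.evalFn g) (C.evalFn y) X) := by
    intro X y
    induction X with
    | zero => simp
    | add X Y hX hY => simp only [map_add, hX, hY]
    | tmul a a' =>
      simp only [LinearMap.rTensor_tmul, TensorProduct.lid_tmul, map_smul,
        TensorProduct.map_tmul, LinearMap.mul'_apply, smul_eq_mul]
  exact ⟨_, fun y => (h _ y).trans (C.fn_comul b g y)⟩

theorem contractLeft_apply (D : H →ₗ[K] Module.Dual K (LieAlg (E := E) K G)) {M : Type*}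
    [AddCommGroup M] [Module K M] (α : M →ₗ[K] K) (p : LieAlg (E := E) K G) (X : M ⊗[K] H) :
    contractLeft D α X p = LinearMap.mul' K K (TensorProduct.map α (D.flip p) X) := by
  induction X with
  | zero => simp
  | add X Y hX hY => simp only [map_add, LinearMap.add_apply, hX, hY]
  | tmul m h => simp

theorem contractRight_apply (D : H →ₗ[K] Module.Dual K (LieAlg (E := E) K G)) {M : Type*}
    [AddCommGroup M] [Module K M] (α : M →ₗ[K] K) (p : LieAlg (E := E) K G) (X : H ⊗[K] M) :
    contractRight D α X p = LinearMap.mul' K K (TensorProduct.map (D.flip p) α X) := by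
  induction X with
  | zero => simp
  | add X Y hX hY => simp only [map_add, LinearMap.add_apply, hX, hY]
  | tmul m h => simp [mul_comm]

theorem smooth_and_diffOne_derivL (B : H) (p : LieAlg (E := E) K G) :
    ContMDiff 𝓘(ℝ, E) 𝓘(ℝ, K) ∞ (fun x => derivL (C.fn B) x p) ∧
    diffOne (fun x => derivL (C.fn B) x p) =
      contractRight C.diff (C.diff.flip p) (Coalgebra.comul B) := by
  simp only [← contractLeft_comul, contractLeft_apply]
  exact C.smooth_and_diffOne_contractRight _ _

theorem smooth_and_diffOne_derivR (B : H) (p : LieAlg (E := E) K G) :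
    ContMDiff 𝓘(ℝ, E) 𝓘(ℝ, K) ∞ (fun x => derivR (C.fn B) x p) ∧
    diffOne (fun x => derivR (C.fn B) x p) =
      contractLeft C.diff (C.diff.flip p) (Coalgebra.comul B) := by
  simp only [← contractRight_comul, contractRight_apply]
  exact C.smooth_and_diffOne_contractLeft _ _

/-- Derivatives along a right invariant and a left invariant vector field commute: both orders give
`B₁'(e; p) B₂'(e; q)`. -/
theorem diffOne_derivR_apply (B : H) (p q : LieAlg (E := E) K G) :
    diffOne (fun x => derivR (C.fn B) x p) q = diffOne (fun x => derivL (C.fn B) x q) p := by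
  rw [(C.smooth_and_diffOne_derivR B p).2, (C.smooth_and_diffOne_derivL B q).2,
    contractLeft_apply, contractRight_apply]

theorem smooth_formRightTranslate (τ : Γ) (g : G) (w : TangentSpace 𝓘(ℝ, E) g) :
    ContMDiff 𝓘(ℝ, E) 𝓘(ℝ, K) ∞ fun x => C.form τ (g * x) (transR x g w) := by
  have h := (C.smooth_and_diffOne_contractLeft (C.evalFormAt g w) (C.coactR τ)).1
  have h' : (fun x => LinearMap.mul' K K (TensorProduct.map (C.evalFormAt g w) (C.evalFn x)
      (C.coactR τ))) = fun x => C.form τ (g * x) (transR x g w) :=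
    funext fun x => C.coactR_apply τ x g w
  rwa [h'] at h

theorem smooth_tilde (τ : Γ) (v : GroupLieAlgebra 𝓘(ℝ, E) G) :
    ContMDiff 𝓘(ℝ, E) 𝓘(ℝ, K) ∞ fun x => tilde (C.form τ) x ((1 : K) ⊗ₜ[ℝ] v) := by
  have h := (C.smooth_and_diffOne_contractRight (C.evalFormAt 1 v) (C.coactL τ)).1
  have h' : (fun x => LinearMap.mul' K K (TensorProduct.map (C.evalFn x) (C.evalFormAt 1 v)
      (C.coactL τ))) = fun x => tilde (C.form τ) x ((1 : K) ⊗ₜ[ℝ] v) := by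
    funext x
    rw [tilde_tmul]
    exact (C.coactL_apply τ x 1 v).trans (form_congr_point (E := E) _ (mul_one x) _)
  rwa [h'] at h

/-- The first order part of the twist, antisymmetrised, is the skew part of `r`. -/
theorem sub_eq_pairBilin_skewPart {r : LieAlg (E := E) K G ⊗[K] LieAlg (E := E) K G}
    {f : H ⊗[K] H →ₗ[K] K} (hf : C.Quantises f r)
    (a b : H) :
    f (b ⊗ₜ[K] a) - f (a ⊗ₜ[K] b) = pairBilin (skewPart r) (C.diff a) (C.diff b) := by
  have h := hf a b
  rw [tensorPair, tensorPair, pair_symmPart] at h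
  rw [pairBilin_apply, pair_skewPart, C.diff_apply, C.diff_apply]
  linear_combination -h

variable [LieGroup 𝓘(ℝ, E) ∞ G]

theorem smooth_tilde_mul_left (τ : Γ) (g : G) (v : GroupLieAlgebra 𝓘(ℝ, E) G) :
    ContMDiff 𝓘(ℝ, E) 𝓘(ℝ, K) ∞ fun x => tilde (C.form τ) (g * x) ((1 : K) ⊗ₜ[ℝ] v) :=
  (C.smooth_tilde τ v).comp contMDiff_mul_left

/-- The left trivialisation of `db` consists of the left invariant derivatives of `b`. -/
theorem tilde_d_eq_derivL (b : H) (x : G)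
    (v : GroupLieAlgebra 𝓘(ℝ, E) G) :
    tilde (C.form (C.d b)) x ((1 : K) ⊗ₜ[ℝ] v) = derivL (C.fn b) x ((1 : K) ⊗ₜ[ℝ] v) := by
  rw [tilde_tmul, derivL_tmul_eq_mulInvariantVectorField (C.mdifferentiable b), C.form_d]
  rfl

/-- The vector `w x = g v x` is tangent to `y ↦ g y x`, so `db(w x)` is a right invariant derivative
of `y ↦ b(g y)`. -/
theorem form_d_transR (b : H) {g : G} {v : GroupLieAlgebra 𝓘(ℝ, E) G}
    {w : TangentSpace 𝓘(ℝ, E) g}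
    (hw : (show E from mfderiv 𝓘(ℝ, E) 𝓘(ℝ, E) (fun y : G => g * y) 1 v) = w) (x : G) :
    C.form (C.d b) (g * x) (transR x g w) =
      derivR (fun y => C.fn b (g * y)) x ((1 : K) ⊗ₜ[ℝ] v) := by
  have h1 : (show E →L[ℝ] K from mfderiv 𝓘(ℝ, E) 𝓘(ℝ, K) (fun y => C.fn b (y * x)) g) w =
      C.form (C.d b) (g * x) (transR x g w) := by
    rw [C.form_d]
    exact mfderiv_comp_apply_of_eq _ (C.mdifferentiable b (g * x))
      (mdifferentiable_mul_right x g) rfl w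
  have hd : MDifferentiable 𝓘(ℝ, E) 𝓘(ℝ, K) fun y => C.fn b (y * x) :=
    (C.mdifferentiable b).comp (mdifferentiable_mul_right x)
  have h2 : (fun y => C.fn b (g * (y * x))) = (fun y => C.fn b (y * x)) ∘ fun y => g * y :=
    funext fun y => by simp [mul_assoc]
  rw [← h1, derivR, diffOne_tmul, one_mul, h2, diffOneReal]
  refine Eq.symm ((mfderiv_comp_apply_of_eq _ (hd g) (mdifferentiable_mul_left g 1)
    (mul_one g) v).trans ?_)
  exact congrArg (show E →L[ℝ] K from mfderiv 𝓘(ℝ, E) 𝓘(ℝ, K) (fun y => C.fn b (y * x)) g) hw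

/-- The derivatives at `x = 1` of `τ` along the two families of tangent vectors `g v x` and `g x v`
at `g x` differ, in the direction `u`, by `τ(g [v, u])`. It is this bracket that the coadjoint term
of the canonical preconnection supplies. Both sides are compatible with multiplication of `τ` by
functions, so it suffices to treat `τ = db`; there, `db(g v x)` and `db(g x v)` are derivatives of
`y ↦ b(g y)` along right and left invariant vector fields. -/
theorem neg_formRightAct_eq [CompleteSpace E] (τ : Γ) (g : G) {v : GroupLieAlgebra 𝓘(ℝ, E) G}
    {w : TangentSpace 𝓘(ℝ, E) g}
    (hw : (show E from mfderiv 𝓘(ℝ, E) 𝓘(ℝ, E) (fun y : G => g * y) 1 v) = w) :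
    -formRightAct (C.form τ) g w =
      derivL (fun x => tilde (C.form τ) x ((1 : K) ⊗ₜ[ℝ] v)) g +
        tilde (C.form τ) g ∘ₗ bracketBilin K (LieAlg (E := E) K G) ((1 : K) ⊗ₜ[ℝ] v) := by
  rw [formRightAct, neg_neg]
  have md {q : G → K} (hq : ContMDiff 𝓘(ℝ, E) 𝓘(ℝ, K) ∞ q) :
      MDifferentiableAt 𝓘(ℝ, E) 𝓘(ℝ, K) q 1 := hq.mdifferentiable (by simp) 1
  have hτ : τ ∈ Submodule.span H (Set.range C.d) := by
    rw [C.span_d]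
    trivial
  induction hτ using Submodule.span_induction with
  | mem τ hτ =>
    obtain ⟨b, rfl⟩ := hτ
    obtain ⟨B, hB⟩ := C.exists_leftTranslate g b
    have hB' : (fun y => C.fn b (g * y)) = C.fn B := funext fun y => (hB y).symm
    refine dual_ext fun u => ?_
    have hR : (fun x => C.form (C.d b) (g * x) (transR x g w)) =
        fun x => derivR (C.fn B) x ((1 : K) ⊗ₜ[ℝ] v) :=
      funext fun x => by rw [C.form_d_transR b hw, hB']
    have hL (u : GroupLieAlgebra 𝓘(ℝ, E) G) :
        (fun x => tilde (C.form (C.d b)) (g * x) ((1 : K) ⊗ₜ[ℝ] u)) =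
        fun x => derivL (C.fn B) x ((1 : K) ⊗ₜ[ℝ] u) := by
      funext x
      rw [C.tilde_d_eq_derivL, derivL, derivL, ← hB']
      simp only [mul_assoc]
    have hbr : tilde (C.form (C.d b)) g ((1 : K) ⊗ₜ[ℝ] ⁅v, u⁆) =
        diffOne (C.fn B) ((1 : K) ⊗ₜ[ℝ] ⁅v, u⁆) := by
      rw [C.tilde_d_eq_derivL, derivL, hB']
    have hlie : bracketBilin K (LieAlg (E := E) K G) ((1 : K) ⊗ₜ[ℝ] v) ((1 : K) ⊗ₜ[ℝ] u) =
        (1 : K) ⊗ₜ[ℝ] ⁅v, u⁆ := by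
      change ⁅((1 : K) ⊗ₜ[ℝ] v : LieAlg (E := E) K G), ((1 : K) ⊗ₜ[ℝ] u : LieAlg (E := E) K G)⁆ = _
      rw [LieAlgebra.ExtendScalars.bracket_tmul, one_mul]
    have hsm (u : GroupLieAlgebra 𝓘(ℝ, E) G) : MDifferentiable 𝓘(ℝ, E) 𝓘(ℝ, K)
        fun x => derivL (C.fn B) x ((1 : K) ⊗ₜ[ℝ] u) :=
      (C.smooth_and_diffOne_derivL B _).1.mdifferentiable (by simp)
    -- Swapping the right and left invariant derivatives leaves the commutator of the left invariant
    -- ones, which is the derivative along `[v, u]`.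
    rw [LinearMap.add_apply, LinearMap.comp_apply, hlie, hbr, hR, derivL, hL,
      diffOne_derivR_apply, diffOne_tmul_lie (C.fn_smooth B) v u (hsm v) (hsm u)]
    abel
  | zero =>
    have h0 : ∀ x, tilde (C.form 0) x = 0 := fun x => dual_ext fun u => by
      rw [tilde_tmul, map_zero]
      rfl
    have h1 : (fun x => C.form 0 (g * x) (transR x g w)) = fun _ => (0 : K) := by
      rw [map_zero]
      rfl
    rw [h1, derivL]
    simp only [h0, LinearMap.zero_apply, LinearMap.zero_comp, diffOne_const, add_zero]
  | add σ τ _ _ hσ hτ =>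
    have h0 : ∀ x, tilde (C.form (σ + τ)) x = tilde (C.form σ) x + tilde (C.form τ) x :=
      fun x => dual_ext fun u => by
        rw [LinearMap.add_apply, tilde_tmul, tilde_tmul, tilde_tmul, map_add]
        rfl
    have h1 : (fun x => C.form (σ + τ) (g * x) (transR x g w)) =
        fun x => C.form σ (g * x) (transR x g w) + C.form τ (g * x) (transR x g w) := by
      rw [map_add]
      rfl
    rw [h1, diffOne_add (md (C.smooth_formRightTranslate σ g w))
      (md (C.smooth_formRightTranslate τ g w)), hσ, hτ]
    simp only [derivL, h0, LinearMap.add_apply, LinearMap.add_comp]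
    rw [diffOne_add (md (C.smooth_tilde_mul_left σ g v)) (md (C.smooth_tilde_mul_left τ g v))]
    abel
  | smul a τ _ hτ =>
    have h0 : ∀ x, tilde (C.form (a • τ)) x = C.fn a x • tilde (C.form τ) x :=
      fun x => dual_ext fun u => by
        rw [LinearMap.smul_apply, tilde_tmul, tilde_tmul, C.form_smul]
        rfl
    have h1 : (fun x => C.form (a • τ) (g * x) (transR x g w)) =
        fun x => C.fn a (g * x) * C.form τ (g * x) (transR x g w) := by
      funext x
      rw [C.form_smul]
      rfl
    have ha : MDifferentiableAt 𝓘(ℝ, E) 𝓘(ℝ, K) (fun x => C.fn a (g * x)) 1 :=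
      md ((C.fn_smooth a).comp contMDiff_mul_left)
    -- The two translates agree at the identity, so the derivative of the coefficient `a` cancels.
    have hone : C.form τ (g * 1) (transR 1 g w) = tilde (C.form τ) (g * 1) ((1 : K) ⊗ₜ[ℝ] v) := by
      rw [mul_one g, tilde_tmul, hw]
      exact congrArg (show E →L[ℝ] K from C.form τ g)
        (mfderiv_apply_of_eq_id (E := E) (funext fun y : G => mul_one y) w)
    rw [h1, diffOne_mul ha (md (C.smooth_formRightTranslate τ g w)), hτ, hone]
    simp only [derivL, h0, LinearMap.smul_apply, smul_eq_mul]
    rw [diffOne_mul ha (md (C.smooth_tilde_mul_left τ g v)), mul_one, LinearMap.smul_comp, smul_add]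
    abel

end ClassicalCalculus

/-! ### The canonical preconnection -/

section Preconnection

variable {E : Type*} [NormedAddCommGroup E] [NormedSpace ℝ E] {K : Type*} [RCLike K]
  {G : Type*} [TopologicalSpace G] [ChartedSpace E G] [Group G] [LieGroup 𝓘(ℝ, E) ∞ G]
  [CompleteSpace E] {r : LieAlg (E := E) K G ⊗[K] LieAlg (E := E) K G}

/-- Since the Poisson bivector is skew, only the skew part of `r` contributes to it. -/
theorem IsQuasitriangular.poisson_eq (hr : IsQuasitriangular r) {a b : G → K}
    (ha : ContMDiff 𝓘(ℝ, E) 𝓘(ℝ, K) ∞ a) (hb : ContMDiff 𝓘(ℝ, E) 𝓘(ℝ, K) ∞ b) (g : G) :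
    poisson r a b g =
      pair (derivL a g) (derivL b g) (skewPart r) - pair (derivR a g) (derivR b g) (skewPart r) := by
  have h := hr.skew a b ha hb g
  have h2 : poisson r a b g = 2⁻¹ * (poisson r a b g - poisson r b a g) := by
    linear_combination 2⁻¹ * h
  rw [h2, pair_skewPart, pair_skewPart, poisson, poisson]
  ring

/-- The coadjoint term evaluated on `v` replaces the form `ψ` by `ψ([v, ·])`. -/
theorem coadTensor_apply (t : LieAlg (E := E) K G ⊗[K] LieAlg (E := E) K G)
    (φ ψ : Module.Dual K (LieAlg (E := E) K G)) (v : LieAlg (E := E) K G) :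
    coadTensor t φ ψ v = pair φ (ψ ∘ₗ bracketBilin K (LieAlg (E := E) K G) v) t := by
  induction t using TensorProduct.induction_on with
  | zero => simp [coadTensor, pair]
  | add x y hx hy =>
    have h : coadTensor (x + y) φ ψ v = coadTensor x φ ψ v + coadTensor y φ ψ v := by
      simp [coadTensor]
    rw [h, hx, hy]
    simp [pair]
  | tmul x y =>
    simp only [coadTensor, pair, TensorProduct.lift.tmul, TensorProduct.map_tmul,
      LinearMap.mul'_apply]
    rfl

variable {H : Type*} [CommRing H] [HopfAlgebra K H] {Γ : Type*} [AddCommGroup Γ] [Module K Γ]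
  [Module H Γ] (C : ClassicalCalculus E K G H Γ)

/-- The canonical preconnection in terms of the infinitesimal actions. -/
theorem ClassicalCalculus.canonicalPreconn_eq (hr : IsQuasitriangular r) (a : H) (τ : Γ) (g : G)
    (w : TangentSpace 𝓘(ℝ, E) g) :
    canonicalPreconn r (C.fn a) (C.form τ) g w =
      pair (funRightAct (C.fn a) g) (formRightAct (C.form τ) g w) (skewPart r) -
        pair (funLeftAct (C.fn a) g) (formLeftAct (C.form τ) g w) (skewPart r) := by
  set v : GroupLieAlgebra 𝓘(ℝ, E) G :=
    (show E from mfderiv 𝓘(ℝ, E) 𝓘(ℝ, E) (fun y : G => g⁻¹ * y) g w)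
  have hw : (show E from mfderiv 𝓘(ℝ, E) 𝓘(ℝ, E) (fun y : G => g * y) 1 v) = w :=
    mfderiv_mul_left_inv g w
  -- Right invariant derivatives of `τ̃(v)` are Lie derivatives of `τ`, as left translation by `x g`
  -- factors through left translation by `g`.
  have hleft : derivR (fun x => tilde (C.form τ) x ((1 : K) ⊗ₜ[ℝ] v)) g =
      -formLeftAct (C.form τ) g w := by
    rw [formLeftAct, neg_neg, derivR]
    refine congrArg diffOne (funext fun x => ?_)
    rw [tilde_tmul, mfderiv_mul_left_mul x g v hw]
    rfl
  have hpre : canonicalPreconn r (C.fn a) (C.form τ) g w =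
      poisson r (C.fn a) (fun x => tilde (C.form τ) x ((1 : K) ⊗ₜ[ℝ] v)) g +
        coadTensor (skewPart r) (derivL (C.fn a) g) (tilde (C.form τ) g) ((1 : K) ⊗ₜ[ℝ] v) := by
    rw [canonicalPreconn, preconn, preconnTilde, xi, LinearMap.zero_apply, LinearMap.zero_apply,
      zero_add]
  rw [hpre, hr.poisson_eq (C.fn_smooth a) (C.smooth_tilde τ v), coadTensor_apply, hleft,
    funRightAct, funLeftAct]
  have hright := C.neg_formRightAct_eq τ g hw
  rw [← neg_neg (formRightAct (C.form τ) g w), hright]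
  simp only [← pairBilin_apply, map_add, map_neg, LinearMap.neg_apply]
  ring

end Preconnection

end CochainTwist

open CochainTwist in
theorem proposition5p3
    {E : Type*} [NormedAddCommGroup E] [NormedSpace ℝ E] [FiniteDimensional ℝ E] [CompleteSpace E]
    {K : Type*} [RCLike K]
    {G : Type*} [TopologicalSpace G] [ChartedSpace E G] [Group G] [LieGroup 𝓘(ℝ, E) ∞ G]
    (r : LieAlg (E := E) K G ⊗[K] LieAlg (E := E) K G) (hr : IsQuasitriangular r)
    {H : Type*} [CommRing H] [HopfAlgebra K H]
    {Γ : Type*} [AddCommGroup Γ] [Module K Γ] [Module H Γ] [IsScalarTower K H Γ]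
    (C : ClassicalCalculus E K G H Γ)
    (F : InvFunctional K H) (f : H ⊗[K] H →ₗ[K] K) (hF : IsCochain F f) (hf : C.Quantises f r) :
    (∀ a b : H, bulletFun F a b 0 = a * b) ∧
    (∀ (a b : H) (g : G),
      C.fn (bulletFun F a b 1 - bulletFun F b a 1) g = poisson r (C.fn a) (C.fn b) g) ∧
    (∀ (a : H) (τ : Γ), bulletLeft C F a τ 0 = a • τ ∧ bulletRight C F τ a 0 = a • τ) ∧
    (∀ (a : H) (τ : Γ) (g : G) (w : TangentSpace 𝓘(ℝ, E) g),
      C.form (bulletLeft C F a τ 1 - bulletRight C F τ a 1) g w =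
        canonicalPreconn r (C.fn a) (C.form τ) g w) ∧
    (∀ (a : H) (τ : Γ) (g : G) (w : TangentSpace 𝓘(ℝ, E) g),
      C.form (bulletLeft C F a τ 1 - bulletRight C F τ a 1) g w =
        pair (funRightAct (C.fn a) g) (formRightAct (C.form τ) g w) (skewPart r) -
        pair (funLeftAct (C.fn a) g) (formLeftAct (C.form τ) g w) (skewPart r)) := by
  have hforms : ∀ (a : H) (τ : Γ) (g : G) (w : TangentSpace 𝓘(ℝ, E) g),
      C.form (bulletLeft C F a τ 1 - bulletRight C F τ a 1) g w =
        pair (funRightAct (C.fn a) g) (formRightAct (C.form τ) g w) (skewPart r) -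
        pair (funLeftAct (C.fn a) g) (formLeftAct (C.form τ) g w) (skewPart r) := by
    intro a τ g w
    have hℓ : ∀ (b : H) (σ : Γ), C.evalFormAt g w ((Algebra.lsmul K K Γ).toLinearMap b σ) =
        C.evalFn g b * C.evalFormAt g w σ := fun b σ => by
      change C.form (b • σ) g w = _
      rw [C.form_smul]
      rfl
    refine (apply_twistedMul_commutator hF (C.sub_eq_pairBilin_skewPart hf)
      (comul₃ K H) C.coact₃ hℓ a τ).trans ?_
    rw [trimLeft_comul₃, trimRight_comul₃, C.trimLeft_coact₃, C.trimRight_coact₃,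
      C.contractLeft_comul, C.contractRight_comul, C.contractLeft_coactR, C.contractRight_coactL,
      funRightAct, funLeftAct]
    simp only [← pairBilin_apply, map_neg, LinearMap.neg_apply]
  refine ⟨fun a b => ?_, fun a b g => ?_, fun a τ => ⟨?_, ?_⟩, fun a τ g w => ?_, hforms⟩
  · rw [bulletFun, twistedMul_zero hF, trimRight_comul₃, trimRight_comul₃, counitLeft_comul,
      counitLeft_comul, LinearMap.mul_apply']
  · have hℓ : ∀ b c : H, C.evalFn g (LinearMap.mul K H b c) = C.evalFn g b * C.evalFn g c :=
      fun b c => by simp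
    have hflip : (LinearMap.mul K H).flip = LinearMap.mul K H :=
      LinearMap.ext₂ fun b c => mul_comm c b
    have h := apply_twistedMul_commutator hF (C.sub_eq_pairBilin_skewPart hf)
      (comul₃ K H) (comul₃ K H) hℓ a b
    rw [hflip, trimLeft_comul₃, trimRight_comul₃, trimLeft_comul₃, trimRight_comul₃,
      C.contractLeft_comul, C.contractRight_comul, C.contractLeft_comul, C.contractRight_comul] at h
    exact h.trans (hr.poisson_eq (C.fn_smooth a) (C.fn_smooth b) g).symm
  · rw [bulletLeft, twistedMul_zero hF, trimRight_comul₃, C.trimRight_coact₃, counitLeft_comul,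
      C.counitLeft_coactL]
    rfl
  · rw [bulletRight, twistedMul_zero hF, trimRight_comul₃, C.trimRight_coact₃, counitLeft_comul,
      C.counitLeft_coactL]
    rfl
  · rw [hforms, C.canonicalPreconn_eq hr]
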